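/- Let $R$ be an associative ring with identity. All modules are unital. Write $\mathrm{fd}$ and $\mathrm{pd}$ for flat and projective dimension. **Notation.** $\mathcal F_1$ (resp. $\mathcal P_1$) is the class of right $R$-modules $H$ with $\mathrm{fd}_R(H)\le 1$ (resp. $\mathrm{pd}_R(H)\le 1$), and $\mathcal F_1^{fp}$ (resp. $\mathcal P_1^{fp}$) is the subclass of its finitely presented members. For a class $\mathcal C$ of right $R$-modules, $\mathcal C^{\top}$ is the class of left $R$-modules $M$ with $\mathrm{Tor}_1^R(C,M)=0$ for all $C\in\mathcal C$; for a class $\mathcal D$ of left $R$-modules, ${}^{\top}\mathcal D$ is the class of right $R$-modules $N$ with $\mathrm{Tor}_1^R(N,D)=0$ for all $D\in\mathcal D$; and $\widehat{\mathcal C}={}^{\top}(\mathcal C^{\top})$. A left $R$-module is called $\mathcal F_1^{fp}$-flat if it lies in $(\mathcal F_1^{fp})^{\top}$, and $\mathcal P_1$-flat if it lies in $\mathcal P_1^{\top}$. The class $\varinjlim\mathcal C$ consists of all direct limits of direct systems, indexed by directed sets, of modules in $\mathcal C$. A module $M$ is $2$-presented if there is an exact sequence $F_2\to F_1\to F_0\to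 M\to 0$ with all $F_i$ free of finite rank. A left $R$-module $M$ is torsionless if for each $0\ne m\in M$ there is an $R$-linear map $\varphi\colon M\to R$ with $\varphi(m)\neq 0$ (equivalently, $M$ embeds in a direct product of copies of $R$). Finally $M^{+}=\mathrm{Hom}_{\mathbb Z}(M,\mathbb Q/\mathbb Z)$, which is a right module if $M$ is a left module and conversely. The ring $R$ is called right $\mathcal F_1^{fp}$-coherent if every finitely generated flat submodule of a free right $R$-module is finitely presented. **Theorem.** The following conditions are equivalent: 1. $R$ is right $\mathcal F_1^{fp}$-coherent; 2. every direct product of $\mathcal F_1^{fp}$-flat left $R$-modules is $\mathcal F_1^{fp}$-flat; 3. every direct product of flat left $R$-modules is $\mathcal F_1^{fp}$-flat; 4. every direct product of copies of the left $R$-module $R$ is $\mathcal F_1^{fp}$-flat; 5. every inverse limit, over any preordered index set, of $\mathcal F_1^{fp}$-flat left $R$-modules is $\mathcal F_1^{fp}$-flat; 6. every module in $\mathcal F_1^{fp}$ is $2$-presented; 7. $\mathcal F_1^{fp}=\mathcal P_1^{fp}$; 8. a left $R$-module $M$ is $\mathcal F_1^{fp}$-flat if and only if $M^{++}$ is $\mathcal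 F_1^{fp}$-flat; 9. every torsionless left $R$-module is $\mathcal F_1^{fp}$-flat; 10. a left $R$-module is $\mathcal F_1^{fp}$-flat if and only if it is $\mathcal P_1$-flat; 11. $\varinjlim\mathcal F_1^{fp}=\varinjlim\mathcal P_1$; 12. $\widehat{\mathcal P_1}=\widehat{\mathcal F_1^{fp}}$. -/

import Mathlib

open CategoryTheory

universe u

/-! Throughout, left `R`-modules are objects of `ModuleCat R`, and right `R`-modules are objects of
`ModuleCat Rᵐᵒᵖ`, with `a * r` written `MulOpposite.op r • a`. -/

namespace FOneCoherence

noncomputable section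

/-! ### Tensor products over a noncommutative ring, and Tor -/

section Tensor

variable (R : Type u) [Ring R]

/-- The subgroup of `A ⊗_ℤ B` generated by all `a r ⊗ b - a ⊗ r b`. -/
def balancedRel (A B : Type u) [AddCommGroup A] [Module Rᵐᵒᵖ A] [AddCommGroup B] [Module R B] :
    AddSubgroup (TensorProduct ℤ A B) :=
  AddSubgroup.closure {t | ∃ (a : A) (r : R) (b : B),
    t = TensorProduct.tmul ℤ (MulOpposite.op r • a) b - TensorProduct.tmul ℤ a (r • b)}

/-- The abelian group `A ⊗_R B`, for a right `R`-module `A` and a left `R`-module `B`. -/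
abbrev Tensor (A B : Type u) [AddCommGroup A] [Module Rᵐᵒᵖ A] [AddCommGroup B] [Module R B] :
    Type u :=
  TensorProduct ℤ A B ⧸ balancedRel R A B

variable {A A' B B' : Type u} [AddCommGroup A] [Module Rᵐᵒᵖ A] [AddCommGroup A'] [Module Rᵐᵒᵖ A']
  [AddCommGroup B] [Module R B] [AddCommGroup B'] [Module R B']

/-- The pure tensor `a ⊗ b` in `A ⊗_R B`. -/
def tmul (a : A) (b : B) : Tensor R A B := QuotientAddGroup.mk (TensorProduct.tmul ℤ a b)

/-- The additive map `f ⊗ g : A ⊗_R B → A' ⊗_R B'`. -/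
def tensorMap (f : A →ₗ[Rᵐᵒᵖ] A') (g : B →ₗ[R] B') : Tensor R A B →+ Tensor R A' B' :=
  QuotientAddGroup.map _ _
    (TensorProduct.map f.toAddMonoidHom.toIntLinearMap
      g.toAddMonoidHom.toIntLinearMap).toAddMonoidHom (by
      rw [balancedRel, AddSubgroup.closure_le]
      rintro _ ⟨a, r, b, rfl⟩
      apply AddSubgroup.subset_closure
      refine ⟨f a, r, g b, ?_⟩
      rw [← map_smul, ← map_smul]
      exact map_sub (TensorProduct.map f.toAddMonoidHom.toIntLinearMap
        g.toAddMonoidHom.toIntLinearMap).toAddMonoidHom _ _)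

theorem tensorMap_tmul (f : A →ₗ[Rᵐᵒᵖ] A') (g : B →ₗ[R] B') (a : A) (b : B) :
    tensorMap R f g (tmul R a b) = tmul R (f a) (g b) := rfl

variable {R} in
theorem tensor_hom_ext {C : Type*} [AddCommGroup C] {f g : Tensor R A B →+ C}
    (h : ∀ a b, f (tmul R a b) = g (tmul R a b)) : f = g := by
  apply QuotientAddGroup.addMonoidHom_ext
  ext t
  induction t using TensorProduct.induction_on with
  | zero => simp
  | tmul a b => exact h a b
  | add x y hx hy => rw [map_add, map_add, hx, hy]

end Tensor

section Tor

variable {R : Type u} [Ring R]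

/-- The functor `- ⊗_R M` from right `R`-modules to abelian groups, for a left `R`-module `M`. -/
def tensorFunctor (M : ModuleCat.{u} R) : ModuleCat.{u} Rᵐᵒᵖ ⥤ AddCommGrpCat.{u} where
  obj H := AddCommGrpCat.of (Tensor R H M)
  map f := AddCommGrpCat.ofHom (tensorMap R f.hom LinearMap.id)
  map_id _ := AddCommGrpCat.hom_ext (tensor_hom_ext fun _ _ => rfl)
  map_comp _ _ := AddCommGrpCat.hom_ext (tensor_hom_ext fun _ _ => rfl)

instance (M : ModuleCat.{u} R) : (tensorFunctor M).Additive where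
  map_add {_ _ f g} := AddCommGrpCat.hom_ext (tensor_hom_ext fun a b =>
    congrArg QuotientAddGroup.mk (TensorProduct.add_tmul (f.hom a) (g.hom a) b))

/-- `Tor_n^R(H, M)` for a right module `H` and a left module `M`: the value at `H` of the `n`-th
left derived functor of `- ⊗_R M`. -/
def TorGroup (n : ℕ) (H : ModuleCat.{u} Rᵐᵒᵖ) (M : ModuleCat.{u} R) : AddCommGrpCat.{u} :=
  ((tensorFunctor M).leftDerived n).obj H

/-- `𝒞^⊤`: the left modules `M` such that `Tor_1(C, M) = 0` for every `C` in `𝒞`. -/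
def rightTorOrth (C : ObjectProperty (ModuleCat.{u} Rᵐᵒᵖ)) : ObjectProperty (ModuleCat.{u} R) :=
  fun M => ∀ H, C H → Limits.IsZero (TorGroup 1 H M)

/-- `^⊤𝒟`: the right modules `N` such that `Tor_1(N, D) = 0` for every `D` in `𝒟`. -/
def leftTorOrth (D : ObjectProperty (ModuleCat.{u} R)) : ObjectProperty (ModuleCat.{u} Rᵐᵒᵖ) :=
  fun N => ∀ M, D M → Limits.IsZero (TorGroup 1 N M)

/-- The closure `^⊤(𝒞^⊤)` of a class `𝒞` of right modules. -/
def hat (C : ObjectProperty (ModuleCat.{u} Rᵐᵒᵖ)) : ObjectProperty (ModuleCat.{u} Rᵐᵒᵖ) :=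
  leftTorOrth (rightTorOrth C)

end Tor

/-! ### Classes of modules -/

section Classes

variable (R : Type u) [Ring R]

/-- A right module `F` is flat if `F ⊗_R -` preserves injectivity. -/
def IsFlatRight : ObjectProperty (ModuleCat.{u} Rᵐᵒᵖ) := fun F =>
  ∀ (A B : ModuleCat.{u} R) (f : A →ₗ[R] B), Function.Injective f →
    Function.Injective (tensorMap R (LinearMap.id : F →ₗ[Rᵐᵒᵖ] F) f)

/-- A left module `F` is flat if `- ⊗_R F` preserves injectivity. -/
def IsFlatLeft : ObjectProperty (ModuleCat.{u} R) := fun F =>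
  ∀ (A B : ModuleCat.{u} Rᵐᵒᵖ) (f : A →ₗ[Rᵐᵒᵖ] B), Function.Injective f →
    Function.Injective (tensorMap R f (LinearMap.id : F →ₗ[R] F))

/-- The right modules of flat dimension at most `n`: those with a flat resolution
`0 → F_n → ⋯ → F_0 → M → 0`. -/
def FlatDimLE : ℕ → ObjectProperty (ModuleCat.{u} Rᵐᵒᵖ)
  | 0 => IsFlatRight R
  | n + 1 => fun M => ∃ (K F : ModuleCat.{u} Rᵐᵒᵖ) (i : K →ₗ[Rᵐᵒᵖ] F) (p : F →ₗ[Rᵐᵒᵖ] M),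
      IsFlatRight R F ∧ FlatDimLE n K ∧
        Function.Injective i ∧ Function.Exact i p ∧ Function.Surjective p

/-- `𝓕₁`: the right modules of flat dimension at most one. -/
def F1 : ObjectProperty (ModuleCat.{u} Rᵐᵒᵖ) := FlatDimLE R 1

/-- `𝓟₁`: the right modules of projective dimension at most one. -/
def P1 : ObjectProperty (ModuleCat.{u} Rᵐᵒᵖ) := fun M => HasProjectiveDimensionLE M 1

/-- `𝓕₁^fp`: the finitely presented modules in `𝓕₁`. -/
def F1fp : ObjectProperty (ModuleCat.{u} Rᵐᵒᵖ) := fun M =>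
  F1 R M ∧ Module.FinitePresentation Rᵐᵒᵖ M

/-- `𝓟₁^fp`: the finitely presented modules in `𝓟₁`. -/
def P1fp : ObjectProperty (ModuleCat.{u} Rᵐᵒᵖ) := fun M =>
  P1 R M ∧ Module.FinitePresentation Rᵐᵒᵖ M

/-- The `𝓕₁^fp`-flat left modules. -/
def F1fpFlat : ObjectProperty (ModuleCat.{u} R) := rightTorOrth (F1fp R)

/-- The `𝓟₁`-flat left modules. -/
def P1Flat : ObjectProperty (ModuleCat.{u} R) := rightTorOrth (P1 R)

/-- `R` is right `𝓕₁^fp`-coherent: every finitely generated flat submodule of a free right module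
is finitely presented. -/
def IsRightF1fpCoherent : Prop :=
  ∀ (L : ModuleCat.{u} Rᵐᵒᵖ) (N : Submodule Rᵐᵒᵖ L), Module.Free Rᵐᵒᵖ L → N.FG →
    IsFlatRight R (ModuleCat.of Rᵐᵒᵖ N) → Module.FinitePresentation Rᵐᵒᵖ N

end Classes

/-- A module is 2-presented if it admits an exact sequence `F₂ → F₁ → F₀ → M → 0` with `F₀`, `F₁`,
`F₂` free of finite rank. -/
def IsTwoPresented (S : Type*) [Ring S] (M : Type*) [AddCommGroup M] [Module S M] : Prop :=
  ∃ (n₀ n₁ n₂ : ℕ) (d₂ : (Fin n₂ → S) →ₗ[S] (Fin n₁ → S)) (d₁ : (Fin n₁ → S) →ₗ[S] (Fin n₀ → S))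
    (p : (Fin n₀ → S) →ₗ[S] M),
    Function.Exact d₂ d₁ ∧ Function.Exact d₁ p ∧ Function.Surjective p

/-- A module is torsionless if the canonical map to its bidual is injective, that is, if the linear
forms on it separate its points. -/
def IsTorsionless (S : Type*) [Ring S] (M : Type*) [AddCommGroup M] [Module S M] : Prop :=
  ∀ m : M, (∀ φ : M →ₗ[S] S, φ m = 0) → m = 0

open Classical in
/-- `lim→ 𝒞`: the modules that are direct limits of direct systems (indexed by nonempty directed
preordered sets) of modules in `𝒞`. -/
def dirLim {S : Type u} [Ring S] (C : ObjectProperty (ModuleCat.{u} S)) :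
    ObjectProperty (ModuleCat.{u} S) := fun M =>
  ∃ (I : Type u) (_ : Preorder I) (_ : Nonempty I) (_ : IsDirectedOrder I)
    (G : I → ModuleCat.{u} S) (f : ∀ i j, i ≤ j → G i →ₗ[S] G j),
    DirectedSystem (fun i => G i) (fun i j h => f i j h) ∧ (∀ i, C (G i)) ∧
      Nonempty (M ≃ₗ[S] Module.DirectLimit (fun i => G i) f)

/-- The inverse limit of an inverse system of modules: the submodule of compatible families in the
product. -/
def inverseLimit {S : Type u} [Ring S] {I : Type u} [Preorder I] (M : I → ModuleCat.{u} S)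
    (f : ∀ ⦃i j : I⦄, i ≤ j → M j →ₗ[S] M i) : Submodule S (∀ i, M i) where
  carrier := {x | ∀ ⦃i j : I⦄ (h : i ≤ j), f h (x j) = x i}
  add_mem' := fun hx hy i j h => by simp [hx h, hy h]
  zero_mem' := fun i j h => by simp
  smul_mem' := fun c x hx i j h => by simp [hx h]

/-! ### Character modules -/

section Character

variable {R : Type u} [Ring R]

/-- The right module structure `(χ r)(m) = χ (r m)` on the character group of a left module. -/
abbrev characterModuleOfLeft (M : Type u) [AddCommGroup M] [Module R M] :
    Module Rᵐᵒᵖ (M →+ AddCircle (1 : ℚ)) where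
  smul s χ := χ.comp (DistribSMul.toAddMonoidHom M (MulOpposite.unop s))
  one_smul χ := by ext m; exact congrArg χ (one_smul R m)
  mul_smul s t χ := by
    ext m; exact congrArg χ (mul_smul (MulOpposite.unop t) (MulOpposite.unop s) m)
  smul_zero s := rfl
  smul_add s χ ψ := rfl
  add_smul s t χ := by
    ext m
    exact (congrArg χ (add_smul (MulOpposite.unop s) (MulOpposite.unop t) m)).trans (map_add χ _ _)
  zero_smul χ := by ext m; exact (congrArg χ (zero_smul R m)).trans (map_zero χ)

/-- The left module structure `(r χ)(m) = χ (m r)` on the character group of a right module. -/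
abbrev characterModuleOfRight (N : Type u) [AddCommGroup N] [Module Rᵐᵒᵖ N] :
    Module R (N →+ AddCircle (1 : ℚ)) where
  smul r χ := χ.comp (DistribSMul.toAddMonoidHom N (MulOpposite.op r))
  one_smul χ := by ext m; exact congrArg χ (one_smul Rᵐᵒᵖ m)
  mul_smul s t χ := by
    ext m; exact congrArg χ (mul_smul (MulOpposite.op t) (MulOpposite.op s) m)
  smul_zero s := rfl
  smul_add s χ ψ := rfl
  add_smul s t χ := by
    ext m
    exact (congrArg χ (add_smul (MulOpposite.op s) (MulOpposite.op t) m)).trans (map_add χ _ _)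
  zero_smul χ := by ext m; exact (congrArg χ (zero_smul Rᵐᵒᵖ m)).trans (map_zero χ)

/-- `M⁺ = Hom_ℤ(M, ℚ/ℤ)`, a right module, for a left module `M`. -/
def charOfLeft (M : ModuleCat.{u} R) : ModuleCat.{u} Rᵐᵒᵖ :=
  letI := characterModuleOfLeft (R := R) M
  ModuleCat.of Rᵐᵒᵖ (M →+ AddCircle (1 : ℚ))

/-- `N⁺ = Hom_ℤ(N, ℚ/ℤ)`, a left module, for a right module `N`. -/
def charOfRight (N : ModuleCat.{u} Rᵐᵒᵖ) : ModuleCat.{u} R :=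
  letI := characterModuleOfRight (R := R) N
  ModuleCat.of R (N →+ AddCircle (1 : ℚ))

/-- `M⁺⁺` for a left module `M`. -/
def doubleChar (M : ModuleCat.{u} R) : ModuleCat.{u} R := charOfRight (charOfLeft M)

end Character

end

end FOneCoherence

open FOneCoherence

/-! Given a short exact sequence `0 → K → F → H → 0` with `F` flat, `Tor_1(H, M) = 0` exactly when
`K ⊗ M → F ⊗ M` is injective (`isZero_tor_iff_injective`). Both flatness notions thus become
injectivity tests: on inclusions of finitely generated flat submodules of `R^n` (`F1fpFlat_iff`),
and on injections of projective modules (`P1Flat_iff`). Flat test kernels make the first class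
closed under submodules (`F1fpFlat_of_injective`). Projective test kernels make the second closed
under products and double duals, since `K ⊗ ∏ M_i → ∏ (K ⊗ M_i)` and `K ⊗ M⁺⁺ → (K ⊗ M)⁺⁺` are
injective for projective `K`.

Coherence makes the finitely generated flat kernels finitely presented, hence projective, so `F1fp =
P1fp`. As `P1fp` already tests `P1`-flatness (`P1Flat_of_P1fpFlat`), the two flatness classes then
agree, and the first inherits closure under products and double duals. Conversely, Chase's argument
(`finitePresentation_of_injective_tensorMap_pi`) recovers coherence from the powers `R^I`. Inverse
limits and torsionless modules are compared with powers by closure under submodules; double duals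
lead to powers because `R^I` embeds in `(R^(I))⁺⁺`.

For direct limits, Lenzing's criterion (`dirLim_of_forall_factor`) and the factorization
`exists_factor_P1fp` give `lim→ P1fp = lim→ P1`. In the other direction, a finitely presented module
in `lim→ P1` is a retract of a member of `P1`. -/

namespace FOneCoherence

noncomputable section

/-! ### Universal property and right exactness of the tensor product. -/

section TensorBasics

variable {R : Type u} [Ring R]
variable {A A' A'' B B' B'' : Type u} [AddCommGroup A] [Module Rᵐᵒᵖ A] [AddCommGroup A']
  [Module Rᵐᵒᵖ A'] [AddCommGroup A''] [Module Rᵐᵒᵖ A'']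
  [AddCommGroup B] [Module R B] [AddCommGroup B'] [Module R B'] [AddCommGroup B''] [Module R B'']

theorem tensor_induction {P : Tensor R A B → Prop} (t : Tensor R A B) (zero : P 0)
    (tmul : ∀ a b, P (tmul R a b)) (add : ∀ x y, P x → P y → P (x + y)) : P t := by
  obtain ⟨t, rfl⟩ := QuotientAddGroup.mk_surjective t
  induction t using TensorProduct.induction_on with
  | zero => exact zero
  | tmul a b => exact tmul a b
  | add x y hx hy => exact add _ _ hx hy

theorem tmul_add (a : A) (b b' : B) : tmul R a (b + b') = tmul R a b + tmul R a b' :=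
  congrArg QuotientAddGroup.mk (TensorProduct.tmul_add a b b')

theorem add_tmul (a a' : A) (b : B) : tmul R (a + a') b = tmul R a b + tmul R a' b :=
  congrArg QuotientAddGroup.mk (TensorProduct.add_tmul a a' b)

theorem smul_tmul (r : R) (a : A) (b : B) :
    tmul R (MulOpposite.op r • a) b = tmul R a (r • b) := by
  rw [← sub_eq_zero]
  exact (QuotientAddGroup.eq_zero_iff _).2 (AddSubgroup.subset_closure ⟨a, r, b, rfl⟩)

/-- The additive map `b ↦ a ⊗ b`. -/
def tmulRight (a : A) : B →+ Tensor R A B where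
  toFun b := tmul R a b
  map_zero' := by simpa using tmul_add (R := R) a (0 : B) 0
  map_add' := tmul_add a

/-- The additive map `a ↦ a ⊗ b`. -/
def tmulLeft (b : B) : A →+ Tensor R A B where
  toFun a := tmul R a b
  map_zero' := by simpa using add_tmul (R := R) (0 : A) 0 b
  map_add' a a' := add_tmul a a' b

theorem tmul_zero (a : A) : tmul R a (0 : B) = 0 := map_zero (tmulRight a)

theorem zero_tmul (b : B) : tmul R (0 : A) b = 0 := map_zero (tmulLeft b)

theorem sum_tmul {ι : Type*} (s : Finset ι) (a : ι → A) (b : B) :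
    tmul R (∑ i ∈ s, a i) b = ∑ i ∈ s, tmul R (a i) b := map_sum (tmulLeft b) a s

/-- The additive map out of `A ⊗_R B` defined by a balanced biadditive map. -/
def tensorLift {C : Type*} [AddCommGroup C] (f : A →+ B →+ C)
    (hf : ∀ a (r : R) b, f (MulOpposite.op r • a) b = f a (r • b)) : Tensor R A B →+ C :=
  QuotientAddGroup.lift _ (TensorProduct.liftAddHom f fun n a b => by simp) (by
    rw [balancedRel, AddSubgroup.closure_le]
    rintro _ ⟨a, r, b, rfl⟩
    rw [SetLike.mem_coe, AddMonoidHom.mem_ker, map_sub, sub_eq_zero]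
    exact hf a r b)

@[simp]
theorem tensorLift_tmul {C : Type*} [AddCommGroup C] (f : A →+ B →+ C)
    (hf : ∀ a (r : R) b, f (MulOpposite.op r • a) b = f a (r • b)) (a : A) (b : B) :
    tensorLift f hf (tmul R a b) = f a b := rfl

theorem tensorMap_id : tensorMap R (LinearMap.id : A →ₗ[Rᵐᵒᵖ] A) (LinearMap.id : B →ₗ[R] B) =
    AddMonoidHom.id _ :=
  tensor_hom_ext fun _ _ => rfl

theorem tensorMap_tensorMap (f : A →ₗ[Rᵐᵒᵖ] A') (f' : A' →ₗ[Rᵐᵒᵖ] A'') (g : B →ₗ[R] B')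
    (g' : B' →ₗ[R] B'') (t : Tensor R A B) :
    tensorMap R f' g' (tensorMap R f g t) = tensorMap R (f' ∘ₗ f) (g' ∘ₗ g) t :=
  DFunLike.congr_fun (tensor_hom_ext (f := (tensorMap R f' g').comp (tensorMap R f g))
    (g := tensorMap R (f' ∘ₗ f) (g' ∘ₗ g)) fun _ _ => rfl) t

/-- Maps of the two factors commute. -/
theorem tensorMap_swap (f : A →ₗ[Rᵐᵒᵖ] A') (g : B →ₗ[R] B') (t : Tensor R A B) :
    tensorMap R f LinearMap.id (tensorMap R LinearMap.id g t) =
      tensorMap R LinearMap.id g (tensorMap R f LinearMap.id t) := by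
  simp only [tensorMap_tensorMap, LinearMap.id_comp, LinearMap.comp_id]

theorem tensorMap_zero_left (g : B →ₗ[R] B') (t : Tensor R A B) :
    tensorMap R (0 : A →ₗ[Rᵐᵒᵖ] A') g t = 0 :=
  DFunLike.congr_fun (tensor_hom_ext (g := 0) fun _ b => zero_tmul (g b)) t

theorem tensorMap_zero_right (f : A →ₗ[Rᵐᵒᵖ] A') (t : Tensor R A B) :
    tensorMap R f (0 : B →ₗ[R] B') t = 0 :=
  DFunLike.congr_fun (tensor_hom_ext (g := 0) fun a _ => tmul_zero (f a)) t

theorem tensorMap_surjective {f : A →ₗ[Rᵐᵒᵖ] A'} {g : B →ₗ[R] B'} (hf : Function.Surjective f)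
    (hg : Function.Surjective g) : Function.Surjective (tensorMap R f g) := by
  intro t
  induction t using tensor_induction with
  | zero => exact ⟨0, map_zero _⟩
  | tmul a b =>
    obtain ⟨a, rfl⟩ := hf a
    obtain ⟨b, rfl⟩ := hg b
    exact ⟨tmul R a b, rfl⟩
  | add x y hx hy =>
    obtain ⟨x, rfl⟩ := hx
    obtain ⟨y, rfl⟩ := hy
    exact ⟨x + y, map_add _ _ _⟩

variable (B) in
/-- `- ⊗_R B` is right exact. -/
theorem tensorMap_exact_left {i : A →ₗ[Rᵐᵒᵖ] A'} {p : A' →ₗ[Rᵐᵒᵖ] A''} (h : Function.Exact i p)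
    (hp : Function.Surjective p) :
    Function.Exact (tensorMap R i (LinearMap.id : B →ₗ[R] B))
      (tensorMap R p (LinearMap.id : B →ₗ[R] B)) := by
  let Q := Tensor R A' B ⧸ (tensorMap R i (LinearMap.id : B →ₗ[R] B)).range
  let π : Tensor R A' B →+ Q := QuotientAddGroup.mk' _
  have hπ : ∀ a b, π (tmul R (i a) b) = 0 := fun a b =>
    (QuotientAddGroup.eq_zero_iff _).2 ⟨tmul R a b, rfl⟩
  have key : ∀ {a a' : A'} (b : B), p a = p a' → π (tmul R a b) = π (tmul R a' b) := by
    intro a a' b haa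
    obtain ⟨k, hk⟩ := (h (a - a')).1 (by rw [map_sub, haa, sub_self])
    rw [← sub_add_cancel a a', ← hk, add_tmul, map_add, hπ, zero_add]
  -- The section `s` is only set-theoretic: it is additive and linear up to the image of `i`, which
  -- `π` kills by `key`, so it still induces a map from `A'' ⊗ B` to the cokernel.
  let s := Function.surjInv hp
  have hs : ∀ a, p (s a) = a := Function.surjInv_eq hp
  let σ : Tensor R A'' B →+ Q := tensorLift
    (AddMonoidHom.mk' (fun a => π.comp (tmulRight (s a))) fun a a' => by
      ext b
      change π (tmul R _ b) = π (tmul R _ b) + π (tmul R _ b)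
      rw [← map_add, ← add_tmul]
      exact key b (by simp [hs]))
    (fun a r b => by
      change π (tmul R _ b) = π (tmul R _ (r • b))
      rw [← smul_tmul]
      exact key b (by simp [hs]))
  have hσ : σ.comp (tensorMap R p LinearMap.id) = π :=
    tensor_hom_ext fun a b => key b (hs _)
  intro t
  constructor
  · intro ht
    have : π t = 0 := by rw [← hσ, AddMonoidHom.comp_apply, ht, map_zero]
    exact (QuotientAddGroup.eq_zero_iff _).1 this
  · rintro ⟨t, rfl⟩
    rw [tensorMap_tensorMap, show p ∘ₗ i = 0 from LinearMap.ext h.apply_apply_eq_zero,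
      tensorMap_zero_left]

variable (A) in
/-- `A ⊗_R -` is right exact. -/
theorem tensorMap_exact_right {i : B →ₗ[R] B'} {p : B' →ₗ[R] B''} (h : Function.Exact i p)
    (hp : Function.Surjective p) :
    Function.Exact (tensorMap R (LinearMap.id : A →ₗ[Rᵐᵒᵖ] A) i)
      (tensorMap R (LinearMap.id : A →ₗ[Rᵐᵒᵖ] A) p) := by
  let Q := Tensor R A B' ⧸ (tensorMap R (LinearMap.id : A →ₗ[Rᵐᵒᵖ] A) i).range
  let π : Tensor R A B' →+ Q := QuotientAddGroup.mk' _
  have hπ : ∀ a b, π (tmul R a (i b)) = 0 := fun a b =>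
    (QuotientAddGroup.eq_zero_iff _).2 ⟨tmul R a b, rfl⟩
  have key : ∀ (a : A) {b b' : B'}, p b = p b' → π (tmul R a b) = π (tmul R a b') := by
    intro a b b' hbb
    obtain ⟨k, hk⟩ := (h (b - b')).1 (by rw [map_sub, hbb, sub_self])
    rw [← sub_add_cancel b b', ← hk, tmul_add, map_add, hπ, zero_add]
  let s := Function.surjInv hp
  have hs : ∀ a, p (s a) = a := Function.surjInv_eq hp
  let σ : Tensor R A B'' →+ Q := tensorLift
    (AddMonoidHom.flip (AddMonoidHom.mk' (fun b => π.comp (tmulLeft (s b))) fun b b' => by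
      ext a
      change π (tmul R a _) = π (tmul R a _) + π (tmul R a _)
      rw [← map_add, ← tmul_add]
      exact key a (by simp [hs])))
    (fun a r b => by
      change π (tmul R _ _) = π (tmul R a _)
      rw [smul_tmul]
      exact key a (by simp [hs]))
  have hσ : σ.comp (tensorMap R LinearMap.id p) = π :=
    tensor_hom_ext fun a b => key a (hs _)
  intro t
  constructor
  · intro ht
    have : π t = 0 := by rw [← hσ, AddMonoidHom.comp_apply, ht, map_zero]
    exact (QuotientAddGroup.eq_zero_iff _).1 this
  · rintro ⟨t, rfl⟩
    rw [tensorMap_tensorMap, show p ∘ₗ i = 0 from LinearMap.ext h.apply_apply_eq_zero,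
      tensorMap_zero_right]

end TensorBasics

/-! ### Tensor products with free modules. -/

section FreeTensor

variable {R : Type u} [Ring R]
variable {A A' B B' : Type u} [AddCommGroup A] [Module Rᵐᵒᵖ A] [AddCommGroup A'] [Module Rᵐᵒᵖ A']
  [AddCommGroup B] [Module R B] [AddCommGroup B'] [Module R B']

variable (R B) in
/-- The additive map `R^(J) ⊗_R B → B^(J)` multiplying in each coordinate. -/
def freeTensorHom (J : Type u) : Tensor R (J →₀ Rᵐᵒᵖ) B →+ (J →₀ B) :=
  tensorLift (Finsupp.liftAddHom fun j => AddMonoidHom.flip (AddMonoidHom.mk'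
      (fun b => (Finsupp.singleAddHom j).comp (AddMonoidHom.mk' (fun r : Rᵐᵒᵖ => r.unop • b)
        fun r s => by simp [add_smul])) fun b b' => by ext; simp))
    (fun x r b => by
      induction x using Finsupp.induction_linear with
      | zero => rw [smul_zero, map_zero, AddMonoidHom.zero_apply, AddMonoidHom.zero_apply]
      | add x y hx hy => simp only [smul_add, map_add, AddMonoidHom.add_apply, hx, hy]
      | single j s =>
        rw [Finsupp.smul_single, Finsupp.liftAddHom_apply_single, Finsupp.liftAddHom_apply_single]
        exact congrArg (Finsupp.single j) (mul_smul s.unop r b))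

theorem freeTensorHom_single_tmul {J : Type u} (j : J) (s : Rᵐᵒᵖ) (b : B) :
    freeTensorHom R B J (tmul R (Finsupp.single j s) b) = Finsupp.single j (s.unop • b) := by
  rw [freeTensorHom, tensorLift_tmul, Finsupp.liftAddHom_apply_single]
  rfl

variable (R B) in
/-- The isomorphism of `R^(J) ⊗_R B` with `B^(J)`. -/
def freeTensorEquiv (J : Type u) : Tensor R (J →₀ Rᵐᵒᵖ) B ≃+ (J →₀ B) :=
  AddMonoidHom.toAddEquiv (freeTensorHom R B J)
    (Finsupp.liftAddHom fun j => tmulRight (Finsupp.single j 1))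
    (tensor_hom_ext fun x b => by
      induction x using Finsupp.induction_linear with
      | zero => simp only [zero_tmul, map_zero]
      | add x y hx hy => rw [add_tmul, map_add, map_add, hx, hy]
      | single j s =>
        rw [AddMonoidHom.comp_apply, freeTensorHom_single_tmul, Finsupp.liftAddHom_apply_single]
        change tmul R _ _ = tmul R _ _
        rw [← smul_tmul, Finsupp.smul_single, smul_eq_mul, mul_one, MulOpposite.op_unop])
    (Finsupp.addHom_ext fun j b => by
      rw [AddMonoidHom.comp_apply, Finsupp.liftAddHom_apply_single]
      refine (freeTensorHom_single_tmul j 1 b).trans ?_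
      rw [MulOpposite.unop_one, one_smul]; rfl)

theorem freeTensorEquiv_single_tmul {J : Type u} (j : J) (s : Rᵐᵒᵖ) (b : B) :
    freeTensorEquiv R B J (tmul R (Finsupp.single j s) b) = Finsupp.single j (s.unop • b) :=
  freeTensorHom_single_tmul j s b

theorem freeTensorEquiv_symm_single {J : Type u} (j : J) (b : B) :
    (freeTensorEquiv R B J).symm (Finsupp.single j b) = tmul R (Finsupp.single j 1) b := by
  rw [AddEquiv.symm_apply_eq, freeTensorEquiv_single_tmul]; simp

theorem freeTensor_hom_ext {J : Type u} {C : Type*} [AddCommGroup C]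
    {f g : Tensor R (J →₀ Rᵐᵒᵖ) B →+ C}
    (h : ∀ j b, f (tmul R (Finsupp.single j 1) b) = g (tmul R (Finsupp.single j 1) b)) : f = g := by
  have : f.comp (freeTensorEquiv R B J).symm.toAddMonoidHom =
      g.comp (freeTensorEquiv R B J).symm.toAddMonoidHom := by
    ext j b
    simpa [freeTensorEquiv_symm_single] using h j b
  ext1
  ext t
  simpa using DFunLike.congr_fun this (freeTensorEquiv R B J (QuotientAddGroup.mk t))

theorem freeTensorEquiv_tensorMap {J : Type u} (g : B →ₗ[R] B') (t : Tensor R (J →₀ Rᵐᵒᵖ) B) :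
    freeTensorEquiv R B' J (tensorMap R LinearMap.id g t) =
      Finsupp.mapRange g (map_zero g) (freeTensorEquiv R B J t) :=
  DFunLike.congr_fun (freeTensor_hom_ext
    (f := (freeTensorEquiv R B' J).toAddMonoidHom.comp (tensorMap R LinearMap.id g))
    (g := (Finsupp.mapRange.addMonoidHom g.toAddMonoidHom).comp
      (freeTensorEquiv R B J).toAddMonoidHom)
    fun j b => by simp [tensorMap_tmul, freeTensorEquiv_single_tmul]) t

variable (R A) in
/-- The additive map `A ⊗_R R^(J) → A^(J)` multiplying in each coordinate. -/
def tensorFreeHom (J : Type u) : Tensor R A (J →₀ R) →+ (J →₀ A) :=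
  tensorLift (AddMonoidHom.flip (Finsupp.liftAddHom fun j => AddMonoidHom.flip
      (AddMonoidHom.mk' (fun a => (Finsupp.singleAddHom j).comp (AddMonoidHom.mk'
        (fun r : R => MulOpposite.op r • a) fun r s => by simp [add_smul]))
        fun b b' => by ext; simp)))
    (fun a r x => by
      rw [AddMonoidHom.flip_apply, AddMonoidHom.flip_apply]
      induction x using Finsupp.induction_linear with
      | zero => rw [smul_zero, map_zero, AddMonoidHom.zero_apply, AddMonoidHom.zero_apply]
      | add x y hx hy => simp only [smul_add, map_add, AddMonoidHom.add_apply, hx, hy]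
      | single j s =>
        rw [Finsupp.smul_single, Finsupp.liftAddHom_apply_single, Finsupp.liftAddHom_apply_single]
        exact congrArg (Finsupp.single j)
          (mul_smul (MulOpposite.op s) (MulOpposite.op r) a).symm)

theorem tensorFreeHom_tmul_single {J : Type u} (j : J) (s : R) (a : A) :
    tensorFreeHom R A J (tmul R a (Finsupp.single j s)) =
      Finsupp.single j (MulOpposite.op s • a) := by
  rw [tensorFreeHom, tensorLift_tmul, AddMonoidHom.flip_apply, Finsupp.liftAddHom_apply_single]
  rfl

variable (R A) in
/-- The isomorphism of `A ⊗_R R^(J)` with `A^(J)`. -/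
def tensorFreeEquiv (J : Type u) : Tensor R A (J →₀ R) ≃+ (J →₀ A) :=
  AddMonoidHom.toAddEquiv (tensorFreeHom R A J)
    (Finsupp.liftAddHom fun j => tmulLeft (Finsupp.single j 1))
    (tensor_hom_ext fun a x => by
      induction x using Finsupp.induction_linear with
      | zero => simp only [tmul_zero, map_zero]
      | add x y hx hy => rw [tmul_add, map_add, map_add, hx, hy]
      | single j s =>
        rw [AddMonoidHom.comp_apply, tensorFreeHom_tmul_single, Finsupp.liftAddHom_apply_single]
        change tmul R _ _ = tmul R _ _
        rw [smul_tmul, Finsupp.smul_single, smul_eq_mul, mul_one])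
    (Finsupp.addHom_ext fun j a => by
      rw [AddMonoidHom.comp_apply, Finsupp.liftAddHom_apply_single]
      refine (tensorFreeHom_tmul_single j 1 a).trans ?_
      rw [MulOpposite.op_one, one_smul]; rfl)

theorem tensorFreeEquiv_tmul_single {J : Type u} (j : J) (s : R) (a : A) :
    tensorFreeEquiv R A J (tmul R a (Finsupp.single j s)) =
      Finsupp.single j (MulOpposite.op s • a) :=
  tensorFreeHom_tmul_single j s a

theorem tensorFreeEquiv_symm_single {J : Type u} (j : J) (a : A) :
    (tensorFreeEquiv R A J).symm (Finsupp.single j a) = tmul R a (Finsupp.single j 1) := by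
  rw [AddEquiv.symm_apply_eq, tensorFreeEquiv_tmul_single]; simp

theorem tensorFree_hom_ext {J : Type u} {C : Type*} [AddCommGroup C]
    {f g : Tensor R A (J →₀ R) →+ C}
    (h : ∀ j a, f (tmul R a (Finsupp.single j 1)) = g (tmul R a (Finsupp.single j 1))) : f = g := by
  have : f.comp (tensorFreeEquiv R A J).symm.toAddMonoidHom =
      g.comp (tensorFreeEquiv R A J).symm.toAddMonoidHom := by
    ext j b
    simpa [tensorFreeEquiv_symm_single] using h j b
  ext1
  ext t
  simpa using DFunLike.congr_fun this (tensorFreeEquiv R A J (QuotientAddGroup.mk t))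

theorem tensorFreeEquiv_tensorMap {J : Type u} (f : A →ₗ[Rᵐᵒᵖ] A') (t : Tensor R A (J →₀ R)) :
    tensorFreeEquiv R A' J (tensorMap R f LinearMap.id t) =
      Finsupp.mapRange f (map_zero f) (tensorFreeEquiv R A J t) :=
  DFunLike.congr_fun (tensorFree_hom_ext
    (f := (tensorFreeEquiv R A' J).toAddMonoidHom.comp (tensorMap R f LinearMap.id))
    (g := (Finsupp.mapRange.addMonoidHom f.toAddMonoidHom).comp
      (tensorFreeEquiv R A J).toAddMonoidHom)
    fun j b => by simp [tensorMap_tmul, tensorFreeEquiv_tmul_single]) t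

end FreeTensor

end

/-! ### Flat modules, purity and flat presentations. -/

section Flat

variable {R : Type u} [Ring R]
variable {K F H K' F' : Type u} [AddCommGroup K] [Module Rᵐᵒᵖ K] [AddCommGroup F] [Module Rᵐᵒᵖ F]
  [AddCommGroup H] [Module Rᵐᵒᵖ H] [AddCommGroup K'] [Module Rᵐᵒᵖ K'] [AddCommGroup F']
  [Module Rᵐᵒᵖ F']

theorem tensorMap_injective_of_leftInverse (B : Type u) [AddCommGroup B] [Module R B]
    {s : K →ₗ[Rᵐᵒᵖ] F} {r : F →ₗ[Rᵐᵒᵖ] K} (h : r ∘ₗ s = LinearMap.id) :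
    Function.Injective (tensorMap R s (LinearMap.id : B →ₗ[R] B)) := by
  apply Function.LeftInverse.injective (g := tensorMap R r LinearMap.id)
  intro t
  rw [tensorMap_tensorMap, h, LinearMap.id_comp, tensorMap_id, AddMonoidHom.id_apply]

theorem isFlatRight_of_leftInverse {s : K →ₗ[Rᵐᵒᵖ] F} {r : F →ₗ[Rᵐᵒᵖ] K}
    (h : r ∘ₗ s = LinearMap.id) (hF : IsFlatRight R (ModuleCat.of Rᵐᵒᵖ F)) :
    IsFlatRight R (ModuleCat.of Rᵐᵒᵖ K) := by
  intro A B f hf x y hxy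
  apply tensorMap_injective_of_leftInverse (R := R) A h
  apply hF A B f hf
  exact (tensorMap_swap s f x).symm.trans
    ((congrArg (tensorMap R s LinearMap.id) hxy).trans (tensorMap_swap s f y))

theorem isFlatRight_finsupp (J : Type u) : IsFlatRight R (ModuleCat.of Rᵐᵒᵖ (J →₀ Rᵐᵒᵖ)) := by
  intro A B f hf x y hxy
  apply (freeTensorEquiv R A J).injective
  apply Finsupp.mapRange_injective f (map_zero f) hf
  rw [← freeTensorEquiv_tensorMap, ← freeTensorEquiv_tensorMap]
  exact congrArg _ hxy

theorem isFlatLeft_finsupp (J : Type u) : IsFlatLeft R (ModuleCat.of R (J →₀ R)) := by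
  intro A B f hf x y hxy
  apply (tensorFreeEquiv R A J).injective
  apply Finsupp.mapRange_injective f (map_zero f) hf
  rw [← tensorFreeEquiv_tensorMap, ← tensorFreeEquiv_tensorMap]
  exact congrArg _ hxy

variable (R) in
theorem isFlatLeft_self : IsFlatLeft R (ModuleCat.of R R) := by
  let e : R ≃ₗ[R] (PUnit.{u + 1} →₀ R) := (Finsupp.uniqueLinearEquiv R R PUnit.unit).symm
  intro A B f hf x y hxy
  have key := isFlatLeft_finsupp (R := R) PUnit.{u + 1} A B f hf
    (a₁ := tensorMap R LinearMap.id e.toLinearMap x)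
    (a₂ := tensorMap R LinearMap.id e.toLinearMap y)
    ((tensorMap_swap f e.toLinearMap x).trans ((congrArg (tensorMap R LinearMap.id e.toLinearMap)
      hxy).trans (tensorMap_swap f e.toLinearMap y).symm))
  have h := congrArg (tensorMap R LinearMap.id e.symm.toLinearMap) key
  simp only [tensorMap_tensorMap, LinearEquiv.symm_comp, LinearMap.id_comp, tensorMap_id] at h
  exact h

theorem isFlatRight_of_projective [Module.Projective Rᵐᵒᵖ K] :
    IsFlatRight R (ModuleCat.of Rᵐᵒᵖ K) := by
  obtain ⟨s, hs⟩ := Module.projective_def'.1 ‹Module.Projective Rᵐᵒᵖ K›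
  exact isFlatRight_of_leftInverse hs (isFlatRight_finsupp K)

section Pure

variable {i : K →ₗ[Rᵐᵒᵖ] F} {p : F →ₗ[Rᵐᵒᵖ] H}

/-- A chase in the diagram tensoring `0 → K → F → H → 0` with `0 → N → L → M → 0`. Flatness of `H`
puts the obstruction in the image of `K ⊗ N`, and flatness of `L` allows it to be compared inside `K
⊗ L`. -/
theorem tensorMap_injective_of_flat_cokernel_of_presentation {M N L : Type u} [AddCommGroup M] [Module R M]
    [AddCommGroup N] [Module R N] [AddCommGroup L] [Module R L] {j : N →ₗ[R] L} {q : L →ₗ[R] M}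
    (hj : Function.Injective j) (hjq : Function.Exact j q) (hq : Function.Surjective q)
    (hL : IsFlatLeft R (ModuleCat.of R L))
    (hi : Function.Injective i) (h : Function.Exact i p) (hp : Function.Surjective p)
    (hH : IsFlatRight R (ModuleCat.of Rᵐᵒᵖ H)) :
    Function.Injective (tensorMap R i (LinearMap.id : M →ₗ[R] M)) := by
  rw [injective_iff_map_eq_zero]
  intro x hx
  obtain ⟨y, rfl⟩ := tensorMap_surjective (R := R) (f := (LinearMap.id : K →ₗ[Rᵐᵒᵖ] K))
    Function.surjective_id hq x
  rw [tensorMap_swap] at hx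
  obtain ⟨z, hz⟩ := (tensorMap_exact_right F hjq hq _).1 hx
  have hz0 : tensorMap R p LinearMap.id z = 0 := by
    apply (injective_iff_map_eq_zero _).1 (hH (ModuleCat.of R N) (ModuleCat.of R L) j hj)
    refine (tensorMap_swap p j z).symm.trans ?_
    rw [hz]
    exact (tensorMap_exact_left L h hp _).2 ⟨y, rfl⟩
  obtain ⟨w, rfl⟩ := (tensorMap_exact_left _ h hp _).1 hz0
  rw [← tensorMap_swap] at hz
  rw [← hL (ModuleCat.of Rᵐᵒᵖ K) (ModuleCat.of Rᵐᵒᵖ F) i hi hz]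
  exact (tensorMap_exact_right K hjq hq _).2 ⟨w, rfl⟩

/-- A short exact sequence with flat cokernel remains exact after tensoring. -/
theorem tensorMap_injective_of_flat_cokernel (M : Type u) [AddCommGroup M] [Module R M]
    (hi : Function.Injective i) (h : Function.Exact i p) (hp : Function.Surjective p)
    (hH : IsFlatRight R (ModuleCat.of Rᵐᵒᵖ H)) :
    Function.Injective (tensorMap R i (LinearMap.id : M →ₗ[R] M)) :=
  tensorMap_injective_of_flat_cokernel_of_presentation
    (N := LinearMap.ker (Finsupp.linearCombination R (id : M → M))) Subtype.val_injective
    (LinearMap.exact_subtype_ker_map (Finsupp.linearCombination R id))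
    (Finsupp.linearCombination_id_surjective R M) (isFlatLeft_finsupp M) hi h hp hH

/-- Purity of `i` embeds `K ⊗ A` in `F ⊗ A`, where flatness of `F` applies. -/
theorem isFlatRight_kernel (hi : Function.Injective i) (h : Function.Exact i p)
    (hp : Function.Surjective p) (hF : IsFlatRight R (ModuleCat.of Rᵐᵒᵖ F))
    (hH : IsFlatRight R (ModuleCat.of Rᵐᵒᵖ H)) : IsFlatRight R (ModuleCat.of Rᵐᵒᵖ K) := by
  intro A B f hf x y hxy
  apply tensorMap_injective_of_flat_cokernel (R := R) A hi h hp hH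
  apply hF A B f hf
  exact (tensorMap_swap i f x).symm.trans
    ((congrArg (tensorMap R i LinearMap.id) hxy).trans (tensorMap_swap i f y))

/-- A four-lemma argument: flatness of `H` pushes a kernel element back to `K ⊗ A`, and purity of
`i` lets flatness of `K` finish. -/
theorem isFlatRight_extension (hi : Function.Injective i) (h : Function.Exact i p)
    (hp : Function.Surjective p) (hK : IsFlatRight R (ModuleCat.of Rᵐᵒᵖ K))
    (hH : IsFlatRight R (ModuleCat.of Rᵐᵒᵖ H)) : IsFlatRight R (ModuleCat.of Rᵐᵒᵖ F) := by
  intro A B f hf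
  rw [injective_iff_map_eq_zero]
  intro x hx
  change Tensor R F A at x
  change tensorMap R (LinearMap.id : F →ₗ[Rᵐᵒᵖ] F) f x = 0 at hx
  have h0 : tensorMap R p LinearMap.id x = 0 := by
    apply (injective_iff_map_eq_zero _).1 (hH A B f hf)
    refine (tensorMap_swap p f x).symm.trans ?_
    rw [hx, map_zero]
  obtain ⟨k, rfl⟩ := (tensorMap_exact_left A h hp x).1 h0
  rw [← tensorMap_swap] at hx
  have := (injective_iff_map_eq_zero _).1
    (tensorMap_injective_of_flat_cokernel B hi h hp hH) _ hx
  rw [(injective_iff_map_eq_zero _).1 (hK A B f hf) k this, map_zero]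

end Pure

section Pullback

variable {i : K →ₗ[Rᵐᵒᵖ] F} {p : F →ₗ[Rᵐᵒᵖ] H} {i' : K' →ₗ[Rᵐᵒᵖ] F'} {p' : F' →ₗ[Rᵐᵒᵖ] H}

/-- The pullback of two epimorphisms onto `H` is an extension in two ways. -/
theorem exists_pullback {S K F K' F' H : Type u} [Ring S] [AddCommGroup K] [Module S K]
    [AddCommGroup F] [Module S F] [AddCommGroup H] [Module S H] [AddCommGroup K'] [Module S K']
    [AddCommGroup F'] [Module S F'] {i : K →ₗ[S] F} {p : F →ₗ[S] H} {i' : K' →ₗ[S] F'}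
    {p' : F' →ₗ[S] H} (hi : Function.Injective i) (h : Function.Exact i p)
    (hp : Function.Surjective p)
    (hi' : Function.Injective i') (h' : Function.Exact i' p') (hp' : Function.Surjective p') :
    ∃ (E : ModuleCat.{u} S) (a : K →ₗ[S] E) (b : E →ₗ[S] F') (a' : K' →ₗ[S] E)
      (b' : E →ₗ[S] F), Function.Injective a ∧ Function.Exact a b ∧ Function.Surjective b ∧
      Function.Injective a' ∧ Function.Exact a' b' ∧ Function.Surjective b' ∧
      b' ∘ₗ a = i ∧ b ∘ₗ a' = i' := by
  let E := LinearMap.eqLocus (p ∘ₗ LinearMap.fst S F F') (p' ∘ₗ LinearMap.snd S F F')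
  refine ⟨ModuleCat.of S E,
    LinearMap.codRestrict E (LinearMap.inl S F F' ∘ₗ i) fun k => by
      simp [E, LinearMap.mem_eqLocus, h.apply_apply_eq_zero],
    LinearMap.snd S F F' ∘ₗ E.subtype,
    LinearMap.codRestrict E (LinearMap.inr S F F' ∘ₗ i') fun k => by
      simp [E, LinearMap.mem_eqLocus, h'.apply_apply_eq_zero],
    LinearMap.fst S F F' ∘ₗ E.subtype, ?_, ?_, ?_, ?_, ?_, ?_, rfl, rfl⟩
  · intro x y hxy
    exact hi (congrArg (fun z : E => z.1.1) hxy)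
  · rintro ⟨⟨x, y⟩, hxy⟩
    constructor
    · rintro rfl
      obtain ⟨k, rfl⟩ := (h x).1 (by simpa [E, LinearMap.mem_eqLocus] using hxy)
      exact ⟨k, rfl⟩
    · rintro ⟨k, hk⟩
      exact (congrArg (fun z : E => z.1.2) hk).symm
  · intro y
    obtain ⟨x, hx⟩ := hp (p' y)
    exact ⟨⟨(x, y), hx⟩, rfl⟩
  · intro x y hxy
    exact hi' (congrArg (fun z : E => z.1.2) hxy)
  · rintro ⟨⟨x, y⟩, hxy⟩
    constructor
    · rintro rfl
      obtain ⟨k, rfl⟩ := (h' y).1 (by simpa [E, LinearMap.mem_eqLocus, eq_comm] using hxy)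
      exact ⟨k, rfl⟩
    · rintro ⟨k, hk⟩
      exact (congrArg (fun z : E => z.1.1) hk).symm
  · intro y
    obtain ⟨x, hx⟩ := hp' (p y)
    exact ⟨⟨(y, x), hx.symm⟩, rfl⟩

/-- If one flat presentation of `H` stays exact after tensoring with `M`, then so does every short
exact sequence ending in `H`. -/
theorem tensorMap_injective_of_flat_presentation (M : Type u) [AddCommGroup M] [Module R M]
    (hi : Function.Injective i) (h : Function.Exact i p) (hp : Function.Surjective p)
    (hi' : Function.Injective i') (h' : Function.Exact i' p') (hp' : Function.Surjective p')
    (hF' : IsFlatRight R (ModuleCat.of Rᵐᵒᵖ F'))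
    (hinj : Function.Injective (tensorMap R i' (LinearMap.id : M →ₗ[R] M))) :
    Function.Injective (tensorMap R i (LinearMap.id : M →ₗ[R] M)) := by
  obtain ⟨E, a, b, a', b', ha, hab, hb, ha', hab', hb', rfl, rfl⟩ :=
    exists_pullback hi h hp hi' h' hp'
  rw [injective_iff_map_eq_zero]
  intro x hx
  -- The cokernel `F'` of `a` is flat, so vanishing may be checked in `E ⊗ M`.
  have key : Function.Injective (tensorMap R a (LinearMap.id : M →ₗ[R] M)) :=
    tensorMap_injective_of_flat_cokernel M ha hab hb hF'
  apply (injective_iff_map_eq_zero _).1 key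
  -- The image of `x` in `E ⊗ M` dies in `F ⊗ M`, hence comes from `K' ⊗ M`; it also dies in `F' ⊗
  -- M`, where `hinj` detects it.
  obtain ⟨k, hk⟩ := (tensorMap_exact_left M hab' hb' (tensorMap R a LinearMap.id x)).1 (by
    rw [tensorMap_tensorMap]; exact hx)
  rw [← hk, (injective_iff_map_eq_zero _).1 hinj k, map_zero]
  have := (tensorMap_exact_left M hab hb (tensorMap R a LinearMap.id x)).2 ⟨x, rfl⟩
  rw [← hk, tensorMap_tensorMap] at this
  exact this

/-- In a module of flat dimension at most one, the kernel of every flat presentation is flat. -/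
theorem isFlatRight_kernel_of_F1 (hi : Function.Injective i) (h : Function.Exact i p)
    (hp : Function.Surjective p) (hF : IsFlatRight R (ModuleCat.of Rᵐᵒᵖ F))
    (hH : F1 R (ModuleCat.of Rᵐᵒᵖ H)) : IsFlatRight R (ModuleCat.of Rᵐᵒᵖ K) := by
  obtain ⟨K', F', i', p', hF', hK', hi', h', hp'⟩ := hH
  obtain ⟨E, a, b, a', b', ha, hab, hb, ha', hab', hb', rfl, rfl⟩ :=
    exists_pullback hi h hp hi' h' hp'
  -- `E` is an extension of `F` by `K'`, hence flat, and `K` is the kernel of its map onto the flat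
  -- module `F'`.
  exact isFlatRight_kernel ha hab hb (isFlatRight_extension ha' hab' hb' hK' hF) hF'

end Pullback

end Flat

/-! ### Vanishing of Tor as an injectivity condition. -/

section TorCriterion

variable {R : Type u} [Ring R]

/-- Since `g` presents `C` as the cokernel of `f`, exactness of the composite at `B` means that `h`
has no kernel. This reads `Tor_1` off a resolution. -/
theorem exact_comp_iff_injective {A B C D : Type*} [AddGroup A] [AddGroup B] [AddGroup C]
    [AddGroup D] {f : A →+ B} {g : B →+ C} {h : C →+ D} (hfg : Function.Exact f g)
    (hg : Function.Surjective g) :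
    Function.Exact f (h ∘ g) ↔ Function.Injective h := by
  rw [injective_iff_map_eq_zero]
  constructor
  · intro H c hc
    obtain ⟨b, rfl⟩ := hg c
    exact (hfg b).2 ((H b).1 hc)
  · intro H b
    rw [← hfg b]
    exact ⟨H _, fun hb => by rw [Function.comp_apply, hb, map_zero]⟩

/-- Factor `d : P₁ → P₀` in a projective resolution through its image `K`. By right exactness `P₂ ⊗
M → P₁ ⊗ M → K ⊗ M → 0` is exact, so the first homology vanishes iff `K ⊗ M → P₀ ⊗ M` is injective.
-/
theorem exists_projective_presentation_isZero_tor_iff (H : ModuleCat.{u} Rᵐᵒᵖ) :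
    ∃ (K F : ModuleCat.{u} Rᵐᵒᵖ) (i : K →ₗ[Rᵐᵒᵖ] F) (p : F →ₗ[Rᵐᵒᵖ] H),
      Module.Projective Rᵐᵒᵖ F ∧ Function.Injective i ∧ Function.Exact i p ∧
      Function.Surjective p ∧ ∀ M : ModuleCat.{u} R, Limits.IsZero (TorGroup 1 H M) ↔
        Function.Injective (tensorMap R i (LinearMap.id : M →ₗ[R] M)) := by
  let P := projectiveResolution H
  let d := (P.complex.d 1 0).hom
  let d' := (P.complex.d 2 1).hom
  have hd : Function.Exact d' d := (ShortComplex.ShortExact.moduleCat_exact_iff_function_exact _).1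
    (P.exact_succ 0)
  refine ⟨ModuleCat.of Rᵐᵒᵖ (LinearMap.range d), P.complex.X 0, (LinearMap.range d).subtype,
    (P.π.f 0).hom, ?_, Subtype.val_injective, ?_, ?_, ?_⟩
  · exact (IsProjective.iff_projective _).2 (P.projective 0)
  · have := (ShortComplex.ShortExact.moduleCat_exact_iff_function_exact _).1 P.exact₀
    intro x
    refine (this x).trans ?_
    constructor
    · rintro ⟨y, rfl⟩; exact ⟨⟨_, y, rfl⟩, rfl⟩
    · rintro ⟨⟨_, y, rfl⟩, rfl⟩; exact ⟨y, rfl⟩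
  · exact (ModuleCat.epi_iff_surjective _).1 inferInstance
  · intro M
    let T := ((tensorFunctor M).mapHomologicalComplex _).obj P.complex
    have e : TorGroup 1 H M ≅ T.homology 1 := P.isoLeftDerivedObj (tensorFunctor M) 1
    rw [e.isZero_iff, ← HomologicalComplex.exactAt_iff_isZero_homology,
      HomologicalComplex.exactAt_iff' T 2 1 0 (by simp) (by simp),
      ShortComplex.ab_exact_iff_function_exact]
    let q := d.rangeRestrict
    have hq : Function.Surjective q := d.surjective_rangeRestrict
    have hdq : Function.Exact d' q := fun x => (Iff.trans (by
      rw [← (LinearMap.range d).subtype.map_eq_zero_iff Subtype.val_injective]; rfl) (hd x))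
    have := exact_comp_iff_injective (tensorMap_exact_left M hdq hq)
      (h := tensorMap R (LinearMap.range d).subtype (LinearMap.id : M →ₗ[R] M))
      (tensorMap_surjective hq Function.surjective_id)
    rw [← this]
    have h2 : (tensorMap R (LinearMap.range d).subtype (LinearMap.id : M →ₗ[R] M)) ∘
        (tensorMap R q LinearMap.id) = tensorMap R d LinearMap.id := by
      ext t
      rw [Function.comp_apply, tensorMap_tensorMap]
      rfl
    rw [h2]
    rfl

/-- Computation of the vanishing of `Tor_1(H, M)` from a flat presentation of `H`. -/
theorem isZero_tor_iff_injective {H K F : ModuleCat.{u} Rᵐᵒᵖ} {i : K →ₗ[Rᵐᵒᵖ] F}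
    {p : F →ₗ[Rᵐᵒᵖ] H} (hF : IsFlatRight R F) (hi : Function.Injective i)
    (h : Function.Exact i p) (hp : Function.Surjective p) (M : ModuleCat.{u} R) :
    Limits.IsZero (TorGroup 1 H M) ↔
      Function.Injective (tensorMap R i (LinearMap.id : M →ₗ[R] M)) := by
  obtain ⟨K', F', i', p', _, hi', h', hp', key⟩ := exists_projective_presentation_isZero_tor_iff H
  rw [key]
  have hF' : IsFlatRight R F' := isFlatRight_of_projective (K := F')
  exact ⟨tensorMap_injective_of_flat_presentation M hi h hp hi' h' hp' hF',
    tensorMap_injective_of_flat_presentation M hi' h' hp' hi h hp hF⟩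

end TorCriterion

/-! ### Concrete tests for the two kinds of flatness. -/

section Classes

variable {R : Type u} [Ring R]

/-- A finitely presented module of flat dimension at most one is the quotient of a free module of
finite rank by a finitely generated flat submodule. -/
theorem F1fp.exists_presentation {H : ModuleCat.{u} Rᵐᵒᵖ} (hH : F1fp R H) :
    ∃ (n : ℕ) (p : (Fin n → Rᵐᵒᵖ) →ₗ[Rᵐᵒᵖ] H), Function.Surjective p ∧ (LinearMap.ker p).FG ∧
      IsFlatRight R (ModuleCat.of Rᵐᵒᵖ (LinearMap.ker p)) := by
  have := hH.2
  obtain ⟨n, p, hp⟩ := Module.Finite.exists_fin' Rᵐᵒᵖ H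
  refine ⟨n, p, hp, Module.FinitePresentation.fg_ker p hp, ?_⟩
  exact isFlatRight_kernel_of_F1 (K := LinearMap.ker p) (i := (LinearMap.ker p).subtype)
    Subtype.val_injective (LinearMap.exact_subtype_ker_map p) hp
    (isFlatRight_of_projective (K := Fin n → Rᵐᵒᵖ)) hH.1

theorem F1fp_quotient {F : Type u} [AddCommGroup F] [Module Rᵐᵒᵖ F] [Module.Finite Rᵐᵒᵖ F]
    [Module.Projective Rᵐᵒᵖ F] {N : Submodule Rᵐᵒᵖ F} (hN : N.FG)
    (hflat : IsFlatRight R (ModuleCat.of Rᵐᵒᵖ N)) : F1fp R (ModuleCat.of Rᵐᵒᵖ (F ⧸ N)) := by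
  have := Module.finitePresentation_of_projective Rᵐᵒᵖ F
  refine ⟨⟨ModuleCat.of Rᵐᵒᵖ N, ModuleCat.of Rᵐᵒᵖ F, N.subtype, N.mkQ,
    isFlatRight_of_projective, hflat, Subtype.val_injective,
    LinearMap.exact_subtype_mkQ N, N.mkQ_surjective⟩, ?_⟩
  exact Module.finitePresentation_of_surjective N.mkQ N.mkQ_surjective (by rwa [N.ker_mkQ])

/-- Up to isomorphism the members of `F1fp` are the quotients of some `R^n` by a finitely generated
flat submodule. -/
theorem F1fpFlat_iff {M : ModuleCat.{u} R} : F1fpFlat R M ↔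
    ∀ (n : ℕ) (N : Submodule Rᵐᵒᵖ (Fin n → Rᵐᵒᵖ)), N.FG →
      IsFlatRight R (ModuleCat.of Rᵐᵒᵖ N) →
        Function.Injective (tensorMap R N.subtype (LinearMap.id : M →ₗ[R] M)) := by
  constructor
  · intro h n N hN hflat
    exact (isZero_tor_iff_injective (H := ModuleCat.of Rᵐᵒᵖ ((Fin n → Rᵐᵒᵖ) ⧸ N))
      (K := ModuleCat.of Rᵐᵒᵖ N) (F := ModuleCat.of Rᵐᵒᵖ (Fin n → Rᵐᵒᵖ)) (i := N.subtype)
      (p := N.mkQ) isFlatRight_of_projective Subtype.val_injective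
      (LinearMap.exact_subtype_mkQ N) N.mkQ_surjective M).1 (h _ (F1fp_quotient hN hflat))
  · intro h H hH
    obtain ⟨n, p, hp, hfg, hflat⟩ := hH.exists_presentation
    exact (isZero_tor_iff_injective (H := H)
      (K := ModuleCat.of Rᵐᵒᵖ (LinearMap.ker p)) (F := ModuleCat.of Rᵐᵒᵖ (Fin n → Rᵐᵒᵖ))
      (i := (LinearMap.ker p).subtype) (p := p) isFlatRight_of_projective Subtype.val_injective
      (LinearMap.exact_subtype_ker_map p) hp M).2 (h n _ hfg hflat)

/-- The test modules `N` are flat, so `N ⊗ M` embeds in `N ⊗ M'`, and injectivity for `M'` descends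
to `M`. -/
theorem F1fpFlat_of_injective {M M' : ModuleCat.{u} R} (f : M →ₗ[R] M') (hf : Function.Injective f)
    (hM' : F1fpFlat R M') : F1fpFlat R M := by
  rw [F1fpFlat_iff] at hM' ⊢
  intro n N hN hflat x y hxy
  apply hflat M M' f hf
  apply hM' n N hN hflat
  rw [tensorMap_swap, tensorMap_swap, hxy]

theorem F1fpFlat_of_isFlatLeft {M : ModuleCat.{u} R} (hM : IsFlatLeft R M) : F1fpFlat R M := by
  rw [F1fpFlat_iff]
  intro n N _ _
  exact hM (ModuleCat.of Rᵐᵒᵖ N) (ModuleCat.of Rᵐᵒᵖ (Fin n → Rᵐᵒᵖ)) N.subtype Subtype.val_injective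

/-- Dimension shifting along a presentation with projective middle term. -/
theorem P1_iff_projective {H K F : ModuleCat.{u} Rᵐᵒᵖ} {i : K →ₗ[Rᵐᵒᵖ] F} {p : F →ₗ[Rᵐᵒᵖ] H}
    [Module.Projective Rᵐᵒᵖ F] (hi : Function.Injective i) (h : Function.Exact i p)
    (hp : Function.Surjective p) : P1 R H ↔ Module.Projective Rᵐᵒᵖ K := by
  have hS : (ShortComplex.mk (ModuleCat.ofHom i) (ModuleCat.ofHom p)
      (ModuleCat.hom_ext (LinearMap.ext h.apply_apply_eq_zero))).ShortExact :=
    ModuleCat.shortComplex_shortExact _ h hi hp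
  refine (hS.hasProjectiveDimensionLT_X₃_iff 0
    ((IsProjective.iff_projective F).1 inferInstance)).trans ?_
  rw [IsProjective.iff_projective, projective_iff_hasProjectiveDimensionLT_one]

/-- Cokernels of injections of projectives lie in `P1`, and a free presentation of a module in `P1`
has projective kernel. -/
theorem P1Flat_iff {M : ModuleCat.{u} R} : P1Flat R M ↔
    ∀ (K F : ModuleCat.{u} Rᵐᵒᵖ) (i : K →ₗ[Rᵐᵒᵖ] F), Module.Projective Rᵐᵒᵖ K →
      Module.Projective Rᵐᵒᵖ F → Function.Injective i →
        Function.Injective (tensorMap R i (LinearMap.id : M →ₗ[R] M)) := by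
  constructor
  · intro h K F i hK hF hi
    let p := (LinearMap.range i).mkQ
    have hip : Function.Exact i p := by
      rw [LinearMap.exact_iff, Submodule.ker_mkQ]
    have hp : Function.Surjective p := Submodule.mkQ_surjective _
    exact (isZero_tor_iff_injective (H := ModuleCat.of Rᵐᵒᵖ (F ⧸ LinearMap.range i))
      (isFlatRight_of_projective (K := F)) hi hip hp M).1
      (h _ ((P1_iff_projective (H := ModuleCat.of Rᵐᵒᵖ (F ⧸ LinearMap.range i)) hi hip hp).2 hK))
  · intro h H hH
    let p : (H →₀ Rᵐᵒᵖ) →ₗ[Rᵐᵒᵖ] H := Finsupp.linearCombination Rᵐᵒᵖ id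
    have hp : Function.Surjective p := Finsupp.linearCombination_id_surjective Rᵐᵒᵖ H
    have hK := (P1_iff_projective (K := ModuleCat.of Rᵐᵒᵖ (LinearMap.ker p))
      (F := ModuleCat.of Rᵐᵒᵖ (H →₀ Rᵐᵒᵖ)) (i := (LinearMap.ker p).subtype)
      Subtype.val_injective (LinearMap.exact_subtype_ker_map p) hp).1 hH
    exact (isZero_tor_iff_injective (H := H) (K := ModuleCat.of Rᵐᵒᵖ (LinearMap.ker p))
      (F := ModuleCat.of Rᵐᵒᵖ (H →₀ Rᵐᵒᵖ)) (i := (LinearMap.ker p).subtype)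
      isFlatRight_of_projective Subtype.val_injective
      (LinearMap.exact_subtype_ker_map p) hp M).2 (h _ _ _ hK inferInstance Subtype.val_injective)

theorem F1_of_P1 {H : ModuleCat.{u} Rᵐᵒᵖ} (hH : P1 R H) : F1 R H := by
  let p : (H →₀ Rᵐᵒᵖ) →ₗ[Rᵐᵒᵖ] H := Finsupp.linearCombination Rᵐᵒᵖ id
  have hp : Function.Surjective p := Finsupp.linearCombination_id_surjective Rᵐᵒᵖ H
  have hK := (P1_iff_projective (K := ModuleCat.of Rᵐᵒᵖ (LinearMap.ker p))
    (F := ModuleCat.of Rᵐᵒᵖ (H →₀ Rᵐᵒᵖ)) (i := (LinearMap.ker p).subtype)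
    Subtype.val_injective (LinearMap.exact_subtype_ker_map p) hp).1 hH
  exact ⟨ModuleCat.of Rᵐᵒᵖ (LinearMap.ker p), ModuleCat.of Rᵐᵒᵖ (H →₀ Rᵐᵒᵖ),
    (LinearMap.ker p).subtype, p, isFlatRight_of_projective,
    isFlatRight_of_projective (K := ModuleCat.of Rᵐᵒᵖ (LinearMap.ker p)), Subtype.val_injective,
    LinearMap.exact_subtype_ker_map p, hp⟩

theorem P1fp_le_F1fp : P1fp R ≤ F1fp R := fun _ hH => ⟨F1_of_P1 hH.1, hH.2⟩

end Classes

/-! ### Products of `P1`-flat modules. -/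

section Products

variable {R : Type u} [Ring R]
variable {K F : Type u} [AddCommGroup K] [Module Rᵐᵒᵖ K] [AddCommGroup F] [Module Rᵐᵒᵖ F]

/-- Tensoring with a projective module preserves jointly injective families. -/
theorem tensor_eq_zero_of_forall_proj [Module.Projective Rᵐᵒᵖ K] {I : Type*}
    {B : Type u} {M : I → Type u} [AddCommGroup B] [Module R B] [∀ i, AddCommGroup (M i)]
    [∀ i, Module R (M i)] (π : ∀ i, B →ₗ[R] M i) (hπ : ∀ b, (∀ i, π i b = 0) → b = 0)
    (x : Tensor R K B)
    (hx : ∀ i, tensorMap R (LinearMap.id : K →ₗ[Rᵐᵒᵖ] K) (π i) x = 0) : x = 0 := by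
  -- `K` is a retract of a free module, for which the tensor product is a direct sum of copies of
  -- `B` and can be tested coordinatewise.
  obtain ⟨s, hs⟩ := Module.projective_def'.1 ‹Module.Projective Rᵐᵒᵖ K›
  apply (injective_iff_map_eq_zero _).1 (tensorMap_injective_of_leftInverse (R := R) B hs)
  apply (freeTensorEquiv R B K).injective
  rw [map_zero]
  ext j
  apply hπ
  intro i
  have := DFunLike.congr_fun (freeTensorEquiv_tensorMap (π i) (tensorMap R s LinearMap.id x)) j
  rw [← tensorMap_swap, hx, map_zero, map_zero, Finsupp.mapRange_apply] at this
  exact this.symm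

/-- The `K ⊗ M i` separate the elements of `K ⊗ B` because `K` is projective, so a kernel element
may be tested in each factor. -/
theorem P1Flat_of_jointly_injective {I : Type*} {B : ModuleCat.{u} R} {M : I → ModuleCat.{u} R}
    (π : ∀ i, B →ₗ[R] M i) (hπ : ∀ b, (∀ i, π i b = 0) → b = 0) (hM : ∀ i, P1Flat R (M i)) :
    P1Flat R B := by
  rw [P1Flat_iff]
  intro K F f hK hF hf
  rw [injective_iff_map_eq_zero]
  intro x hx
  apply tensor_eq_zero_of_forall_proj π hπ
  intro i
  apply (injective_iff_map_eq_zero _).1 (P1Flat_iff.1 (hM i) K F f hK hF hf)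
  rw [tensorMap_swap, hx, map_zero]

theorem P1Flat_pi {I : Type u} {M : I → ModuleCat.{u} R} (hM : ∀ i, P1Flat R (M i)) :
    P1Flat R (ModuleCat.of R (∀ i, M i)) :=
  P1Flat_of_jointly_injective (B := ModuleCat.of R (∀ i, M i)) (fun i => LinearMap.proj i)
    (fun _ hb => funext hb) hM

end Products

/-! ### Double character modules of `P1`-flat modules. -/

noncomputable section Dual

variable {R : Type u} [Ring R]
variable {K F : Type u} [AddCommGroup K] [Module Rᵐᵒᵖ K] [AddCommGroup F] [Module Rᵐᵒᵖ F]

theorem exists_character_extension {A B : Type*} [AddCommGroup A] [AddCommGroup B] (f : A →+ B)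
    (hf : Function.Injective f) (χ : A →+ AddCircle (1 : ℚ)) :
    ∃ ψ : B →+ AddCircle (1 : ℚ), ψ.comp f = χ :=
  (Module.Baer.of_divisible _).extension_property_addMonoidHom f hf χ

theorem eq_zero_of_character {A : Type*} [AddCommGroup A] {a : A}
    (h : ∀ χ : A →+ AddCircle (1 : ℚ), χ a = 0) : a = 0 :=
  CharacterModule.eq_zero_of_character_apply h

/-- Evaluation, as a linear map `M → M⁺⁺`. -/
def evalDoubleChar (M : ModuleCat.{u} R) : M →ₗ[R] doubleChar M where
  toFun m := (AddMonoidHom.eval m : (M →+ AddCircle (1 : ℚ)) →+ AddCircle (1 : ℚ))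
  map_add' m m' := AddMonoidHom.ext fun χ : M →+ AddCircle (1 : ℚ) => map_add χ m m'
  map_smul' _ _ := rfl

theorem evalDoubleChar_injective (M : ModuleCat.{u} R) : Function.Injective (evalDoubleChar M) := by
  rw [injective_iff_map_eq_zero]
  intro m hm
  exact eq_zero_of_character fun χ =>
    DFunLike.congr_fun (F := (M →+ AddCircle (1 : ℚ)) →+ AddCircle (1 : ℚ)) hm χ

variable (K) in
/-- The natural map `K ⊗_R M⁺⁺ → (K ⊗_R M)⁺⁺`. -/
def tensorDoubleChar (M : ModuleCat.{u} R) : Tensor R K (doubleChar M) →+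
    ((Tensor R K M →+ AddCircle (1 : ℚ)) →+ AddCircle (1 : ℚ)) :=
  tensorLift (AddMonoidHom.mk' (fun k =>
    (AddMonoidHom.mk' (fun ξ : (M →+ AddCircle (1 : ℚ)) →+ AddCircle (1 : ℚ) =>
      AddMonoidHom.mk' (fun χ : Tensor R K M →+ AddCircle (1 : ℚ) => ξ (χ.comp (tmulRight k)))
        (fun χ χ' => by rw [AddMonoidHom.add_comp, map_add]))
      fun ξ ξ' => rfl : ((M →+ AddCircle (1 : ℚ)) →+ AddCircle (1 : ℚ)) →+ _))
    fun k k' => by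
      ext ξ χ
      change ξ _ = ξ _ + ξ _
      rw [← map_add]
      congr 1
      ext m
      change χ (tmul R _ _) = χ (tmul R _ _) + χ (tmul R _ _)
      rw [add_tmul, map_add])
    fun k r ξ => by
      ext χ
      change DFunLike.coe (F := (M →+ AddCircle (1 : ℚ)) →+ AddCircle (1 : ℚ)) ξ _ =
        DFunLike.coe (F := (M →+ AddCircle (1 : ℚ)) →+ AddCircle (1 : ℚ)) ξ _
      congr 1
      ext m
      exact congrArg χ (smul_tmul r k m)

theorem tensorDoubleChar_tensorMap {M : ModuleCat.{u} R} (f : K →ₗ[Rᵐᵒᵖ] F)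
    (x : Tensor R K (doubleChar M)) (χ : Tensor R F M →+ AddCircle (1 : ℚ)) :
    tensorDoubleChar F M (tensorMap R f LinearMap.id x) χ =
      tensorDoubleChar K M x (χ.comp (tensorMap R f LinearMap.id)) := by
  induction x using tensor_induction with
  | zero => simp only [map_zero, AddMonoidHom.zero_apply]
  | tmul k ξ => rfl
  | add x y hx hy => simp only [map_add, AddMonoidHom.add_apply, hx, hy]

theorem tensorDoubleChar_injective_free (J : Type u) (M : ModuleCat.{u} R) :
    Function.Injective (tensorDoubleChar (J →₀ Rᵐᵒᵖ) M) := by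
  rw [injective_iff_map_eq_zero]
  intro x hx
  apply (freeTensorEquiv R (doubleChar M) J).injective
  rw [map_zero]
  ext j
  refine AddMonoidHom.ext (M := M →+ AddCircle (1 : ℚ)) fun ψ => ?_
  let eval : doubleChar M →+ AddCircle (1 : ℚ) :=
    (AddMonoidHom.eval ψ : ((M →+ AddCircle (1 : ℚ)) →+ AddCircle (1 : ℚ)) →+ _)
  -- Evaluating the image of `x` at this character returns the `j`-th coordinate of `x` evaluated at
  -- `ψ`.
  let χ : Tensor R (J →₀ Rᵐᵒᵖ) M →+ AddCircle (1 : ℚ) :=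
    ψ.comp ((Finsupp.applyAddHom j).comp (freeTensorEquiv R M J).toAddMonoidHom)
  have key : eval.comp ((Finsupp.applyAddHom j).comp
      (freeTensorEquiv R (doubleChar M) J).toAddMonoidHom) =
      (AddMonoidHom.eval χ).comp (tensorDoubleChar (J →₀ Rᵐᵒᵖ) M) := by
    apply freeTensor_hom_ext
    intro l ξ
    change eval (freeTensorEquiv R (doubleChar M) J (tmul R (Finsupp.single l 1) ξ) j) =
      DFunLike.coe (F := (M →+ AddCircle (1 : ℚ)) →+ AddCircle (1 : ℚ)) ξ (χ.comp (tmulRight (Finsupp.single l 1)))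
    rw [freeTensorEquiv_single_tmul, MulOpposite.unop_one, one_smul]
    have hχ : ∀ m, χ.comp (tmulRight (Finsupp.single l 1)) m = ψ (Finsupp.single l m j) := by
      intro m
      change ψ (freeTensorEquiv R M J (tmul R (Finsupp.single l 1) m) j) = _
      rw [freeTensorEquiv_single_tmul, MulOpposite.unop_one, one_smul]
    by_cases hlj : l = j
    · subst hlj
      rw [Finsupp.single_eq_same]
      change DFunLike.coe (F := (M →+ AddCircle (1 : ℚ)) →+ AddCircle (1 : ℚ)) ξ ψ = _
      congr 1
      ext m
      rw [hχ, Finsupp.single_eq_same]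
    · rw [Finsupp.single_eq_of_ne' hlj, map_zero]
      have : χ.comp (tmulRight (Finsupp.single l 1)) = 0 := by
        ext m
        rw [hχ, Finsupp.single_eq_of_ne' hlj, map_zero, AddMonoidHom.zero_apply]
      rw [this]
      exact (map_zero (show (M →+ AddCircle (1 : ℚ)) →+ AddCircle (1 : ℚ) from ξ)).symm
  have := DFunLike.congr_fun key x
  simp only [AddMonoidHom.comp_apply, hx, map_zero] at this
  exact this

theorem tensorDoubleChar_injective [Module.Projective Rᵐᵒᵖ K] (M : ModuleCat.{u} R) :
    Function.Injective (tensorDoubleChar K M) := by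
  obtain ⟨s, hs⟩ := Module.projective_def'.1 ‹Module.Projective Rᵐᵒᵖ K›
  rw [injective_iff_map_eq_zero]
  intro x hx
  apply (injective_iff_map_eq_zero _).1 (tensorMap_injective_of_leftInverse (R := R) _ hs)
  apply (injective_iff_map_eq_zero _).1 (tensorDoubleChar_injective_free K M)
  ext χ
  rw [tensorDoubleChar_tensorMap, hx, AddMonoidHom.zero_apply, AddMonoidHom.zero_apply]

/-- Characters of `K ⊗ M` extend along the injection into `F ⊗ M`, so an element of `K ⊗ M⁺⁺` killed
by `f` has zero image in `(K ⊗ M)⁺⁺`, where projectivity of `K` detects it. -/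
theorem P1Flat_doubleChar {M : ModuleCat.{u} R} (hM : P1Flat R M) : P1Flat R (doubleChar M) := by
  rw [P1Flat_iff]
  intro K F f hK hF hf
  rw [injective_iff_map_eq_zero]
  intro x hx
  apply (injective_iff_map_eq_zero _).1 (tensorDoubleChar_injective M)
  ext χ
  obtain ⟨χ, rfl⟩ := exists_character_extension _ (P1Flat_iff.1 hM K F f hK hF hf) χ
  rw [← tensorDoubleChar_tensorMap, hx, map_zero, AddMonoidHom.zero_apply, AddMonoidHom.zero_apply]

end Dual

/-! ### Finitely presented flat modules are projective. -/

section FlatFinitePresentation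

variable {R : Type u} [Ring R]

theorem linearCombination_fintype {S M J : Type*} [Ring S] [AddCommGroup M] [Module S M]
    [Fintype J] (v : J → M) (x : J →₀ S) : Finsupp.linearCombination S v x = ∑ i, x i • v i :=
  (Finsupp.linearCombination_apply S x).trans (Finsupp.sum_fintype _ _ fun _ => zero_smul S _)

theorem tensorMap_comp_left {A A' A'' B : Type u} [AddCommGroup A] [Module Rᵐᵒᵖ A]
    [AddCommGroup A'] [Module Rᵐᵒᵖ A'] [AddCommGroup A''] [Module Rᵐᵒᵖ A''] [AddCommGroup B]
    [Module R B] (f' : A' →ₗ[Rᵐᵒᵖ] A'') (f : A →ₗ[Rᵐᵒᵖ] A') (t : Tensor R A B) :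
    tensorMap R (f' ∘ₗ f) LinearMap.id t =
      tensorMap R f' LinearMap.id (tensorMap R f LinearMap.id t) :=
  (tensorMap_tensorMap f f' LinearMap.id LinearMap.id t).symm

theorem tensorFreeEquiv_tmul_apply {A J : Type u} [AddCommGroup A] [Module Rᵐᵒᵖ A] (a : A)
    (x : J →₀ R) (j : J) :
    tensorFreeEquiv R A J (tmul R a x) j = MulOpposite.op (x j) • a := by
  induction x using Finsupp.induction_linear with
  | zero => simp [tmul_zero]
  | add x y hx hy => simp [tmul_add, hx, hy, add_smul]
  | single l s =>
    rw [tensorFreeEquiv_tmul_single]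
    by_cases h : l = j
    · subst h; simp
    · simp [Finsupp.single_eq_of_ne' h]

theorem tensor_exists_sum {A B : Type u} [AddCommGroup A] [Module Rᵐᵒᵖ A] [AddCommGroup B]
    [Module R B] (t : Tensor R A B) :
    ∃ (n : ℕ) (a : Fin n → A) (b : Fin n → B), t = ∑ i, tmul R (a i) (b i) := by
  induction t using tensor_induction with
  | zero => exact ⟨0, Fin.elim0, Fin.elim0, by simp⟩
  | tmul a b => exact ⟨1, fun _ => a, fun _ => b, by simp⟩
  | add x y hx hy =>
    obtain ⟨n, a, b, rfl⟩ := hx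
    obtain ⟨m, a', b', rfl⟩ := hy
    exact ⟨n + m, Fin.append a a', Fin.append b b', by simp [Fin.sum_univ_add]⟩

/-- Tensoring with a flat module preserves exactness. -/
theorem IsFlatRight.tensorMap_exact {K : Type u} [AddCommGroup K] [Module Rᵐᵒᵖ K]
    (hK : IsFlatRight R (ModuleCat.of Rᵐᵒᵖ K)) {A B C : Type u} [AddCommGroup A] [Module R A]
    [AddCommGroup B] [Module R B] [AddCommGroup C] [Module R C] {f : A →ₗ[R] B} {g : B →ₗ[R] C}
    (h : Function.Exact f g) :
    Function.Exact (tensorMap R (LinearMap.id : K →ₗ[Rᵐᵒᵖ] K) f)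
      (tensorMap R (LinearMap.id : K →ₗ[Rᵐᵒᵖ] K) g) := by
  have hq : Function.Exact f g.rangeRestrict := fun x => (Iff.trans (by
    rw [← (LinearMap.range g).subtype.map_eq_zero_iff Subtype.val_injective]; rfl) (h x))
  have hex := tensorMap_exact_right K hq g.surjective_rangeRestrict
  intro t
  rw [← hex t, ← map_eq_zero_iff _ (hK (ModuleCat.of R (LinearMap.range g)) (ModuleCat.of R C)
    (LinearMap.range g).subtype Subtype.val_injective)]
  have : tensorMap R LinearMap.id (LinearMap.range g).subtype
      (tensorMap R (LinearMap.id : K →ₗ[Rᵐᵒᵖ] K) g.rangeRestrict t) =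
      tensorMap R LinearMap.id g t := by rw [tensorMap_tensorMap]; rfl
  exact Eq.congr this.symm rfl

/-- A finitely presented flat module is projective. -/
theorem projective_of_flat_of_finitePresentation {K : Type u} [AddCommGroup K] [Module Rᵐᵒᵖ K]
    [Module.FinitePresentation Rᵐᵒᵖ K] (hK : IsFlatRight R (ModuleCat.of Rᵐᵒᵖ K)) :
    Module.Projective Rᵐᵒᵖ K := by
  obtain ⟨s, hs, t, ht⟩ := ‹Module.FinitePresentation Rᵐᵒᵖ K›
  let f : (s →₀ Rᵐᵒᵖ) →ₗ[Rᵐᵒᵖ] K := Finsupp.linearCombination Rᵐᵒᵖ ((↑) : s → K)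
  have hf : Function.Surjective f := LinearMap.range_eq_top.mp
    (by rw [Finsupp.range_linearCombination, Subtype.range_val, ← hs])
  -- The relation matrix acting on the other side: its kernel consists of the values on generators
  -- of linear forms `K → R`.
  let φ : (s →₀ R) →ₗ[R] (t →₀ R) := Finsupp.linearCombination R fun i =>
    Finsupp.equivFunOnFinite.symm fun l : t => (l.1 i).unop
  have hφ : ∀ (ν : s →₀ R) (l : t), φ ν l = ∑ i, ν i * (l.1 i).unop := by
    intro ν l
    rw [linearCombination_fintype, Finsupp.finsetSum_apply]
    rfl
  -- The tautological element: applying `φ` turns its coordinates into the relations of `K`, which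
  -- vanish. Flatness then lifts it to `K ⊗ ker φ`.
  let x : Tensor R K (s →₀ R) := ∑ i : s, tmul R i.1 (Finsupp.single i 1)
  have hx : tensorMap R LinearMap.id φ x = 0 := by
    apply (tensorFreeEquiv R K t).injective
    rw [map_zero, map_sum, map_sum]
    ext l
    have key : ∀ i : s, tensorFreeEquiv R K t (tensorMap R LinearMap.id φ
        (tmul R i.1 (Finsupp.single i 1))) l = l.1 i • i.1 := by
      intro i
      rw [tensorMap_tmul, Finsupp.linearCombination_single, one_smul, LinearMap.id_apply,
        tensorFreeEquiv_tmul_apply]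
      rfl
    rw [Finsupp.finsetSum_apply, Finset.sum_congr rfl fun i _ => key i]
    have hl : f l.1 = 0 := by
      have : l.1 ∈ LinearMap.ker f := ht ▸ Submodule.subset_span l.2
      exact this
    exact (linearCombination_fintype _ _).symm.trans hl
  obtain ⟨y, hy⟩ := (hK.tensorMap_exact (A := LinearMap.ker φ) (f := (LinearMap.ker φ).subtype)
    (LinearMap.exact_subtype_ker_map φ) x).1 hx
  obtain ⟨n, a, ν, rfl⟩ := tensor_exists_sum y
  have hfun : ∀ ν : LinearMap.ker φ, ∃ β : K →ₗ[Rᵐᵒᵖ] Rᵐᵒᵖ,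
      ∀ i : s, β i.1 = MulOpposite.op (ν.1 i) := by
    intro ν
    let γ : (s →₀ Rᵐᵒᵖ) →ₗ[Rᵐᵒᵖ] Rᵐᵒᵖ :=
      Finsupp.linearCombination Rᵐᵒᵖ fun i => MulOpposite.op (ν.1 i)
    have hγ : LinearMap.ker f ≤ LinearMap.ker γ := by
      rw [← ht, Submodule.span_le]
      intro l hl
      rw [SetLike.mem_coe, LinearMap.mem_ker, linearCombination_fintype,
        ← MulOpposite.unop_inj, Finset.unop_sum,
        MulOpposite.unop_zero]
      exact (hφ ν.1 ⟨l, hl⟩).symm.trans (DFunLike.congr_fun (LinearMap.mem_ker.1 ν.2) _)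
    refine ⟨(LinearMap.ker f).liftQ γ hγ ∘ₗ (f.quotKerEquivOfSurjective hf).symm.toLinearMap,
      fun i => ?_⟩
    have : (f.quotKerEquivOfSurjective hf).symm i.1 =
        (LinearMap.ker f).mkQ (Finsupp.single i 1) := by
      rw [LinearEquiv.symm_apply_eq]
      simp [f]
    rw [LinearMap.comp_apply, LinearEquiv.coe_coe, this, Submodule.mkQ_apply,
      Submodule.liftQ_apply, Finsupp.linearCombination_single, one_smul]
  choose β hβ using hfun
  -- The `a j` and the forms `β (ν j)` are a finite dual basis: comparing coordinates in `hy` checks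
  -- this on generators.
  refine Module.Projective.of_split (M := Fin n → Rᵐᵒᵖ) (LinearMap.pi fun j => β (ν j))
    (Fintype.linearCombination Rᵐᵒᵖ a) ?_
  rw [← LinearMap.cancel_right hf]
  ext i
  have hi := DFunLike.congr_fun (congrArg (tensorFreeEquiv R K s) hy) i
  simp only [map_sum, tensorMap_tmul, Finsupp.finsetSum_apply, x] at hi
  simp only [tensorFreeEquiv_tmul_apply, LinearMap.id_apply, Submodule.subtype_apply] at hi
  simp only [LinearMap.comp_apply, Finsupp.lsingle_apply, LinearMap.id_apply, f,
    Finsupp.linearCombination_single, one_smul, Fintype.linearCombination_apply, LinearMap.pi_apply,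
    hβ]
  rw [hi, Finset.sum_eq_single i (fun j _ h => by
    rw [Finsupp.single_eq_of_ne' h, MulOpposite.op_zero, zero_smul]) (by simp)]
  rw [Finsupp.single_eq_same, MulOpposite.op_one, one_smul]

end FlatFinitePresentation

/-! ### Chase's argument for powers of the ring. -/

section Chase

variable {R : Type u} [Ring R]
variable {A : Type u} [AddCommGroup A] [Module Rᵐᵒᵖ A]

variable (R A) in
/-- The map `A ⊗_R R → A`. -/
noncomputable def tensorSelfHom : Tensor R A R →+ A :=
  tensorLift (AddMonoidHom.mk' (fun a => AddMonoidHom.mk' (fun r : R => MulOpposite.op r • a)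
      fun r s => by rw [MulOpposite.op_add, add_smul])
    fun a b => by ext r; exact smul_add (MulOpposite.op r) a b)
    fun a r s => (mul_smul (MulOpposite.op s) (MulOpposite.op r) a).symm

theorem tensorSelfHom_tmul (a : A) (r : R) :
    tensorSelfHom R A (tmul R a r) = MulOpposite.op r • a := rfl

/-- Chase's argument: a finitely generated submodule `N` of a finitely generated projective module
is finitely presented if tensoring its inclusion with powers of `R` preserves injectivity. -/
theorem finitePresentation_of_injective_tensorMap_pi {F : Type u} [AddCommGroup F] [Module Rᵐᵒᵖ F]
    [Module.Projective Rᵐᵒᵖ F] {N : Submodule Rᵐᵒᵖ F} (hN : N.FG)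
    (h : ∀ I : Type u, Function.Injective
      (tensorMap R N.subtype (LinearMap.id : (I → R) →ₗ[R] (I → R)))) :
    Module.FinitePresentation Rᵐᵒᵖ N := by
  have : Module.Finite Rᵐᵒᵖ N := Module.Finite.iff_fg.2 hN
  obtain ⟨m, g, hg⟩ := Module.Finite.exists_fin' Rᵐᵒᵖ N
  refine Module.finitePresentation_of_surjective g hg ?_
  let Z := LinearMap.ker g
  let e : Fin m → (Fin m → Rᵐᵒᵖ) := fun i => Pi.single i 1
  -- The power of `R` is indexed by the relation module `Z` itself, and `c i` is the `i`-th
  -- coordinate function on it.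
  let c : Fin m → (Z → R) := fun i z => (z.1 i).unop
  have hsum : ∀ z : Fin m → Rᵐᵒᵖ, ∑ i, z i • e i = z := fun z => by
    ext j; simp [e, Finset.sum_apply, Pi.single_apply]
  -- The `z`-th component of `w` is `z ∈ ker g`. Thus `w` dies componentwise in `F ⊗ R^Z`, hence in
  -- `N ⊗ R^Z`.
  let w : Tensor R (Fin m → Rᵐᵒᵖ) (Z → R) := ∑ i, tmul R (e i) (c i)
  have hw : tensorMap R g LinearMap.id w = 0 := by
    apply (injective_iff_map_eq_zero _).1 (h Z)
    apply tensor_eq_zero_of_forall_proj (fun z : Z => LinearMap.proj (R := R) (φ := fun _ => R) z)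
      fun b hb => funext hb
    intro z
    rw [tensorMap_tensorMap, tensorMap_tensorMap, map_sum]
    have key : ∀ i, tensorMap R ((LinearMap.id ∘ₗ N.subtype) ∘ₗ g)
        ((LinearMap.proj (R := R) (φ := fun _ => R) z ∘ₗ LinearMap.id) ∘ₗ LinearMap.id)
        (tmul R (e i) (c i)) = tmul R (N.subtype (g (z.1 i • e i))) (1 : R) := by
      intro i
      rw [tensorMap_tmul, map_smul, map_smul, ← MulOpposite.op_unop (z.1 i), smul_tmul, smul_eq_mul,
        mul_one]
      rfl
    rw [Finset.sum_congr rfl fun i _ => key i, ← sum_tmul, ← map_sum, ← map_sum, hsum z.1,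
      LinearMap.mem_ker.1 z.2, map_zero, zero_tmul]
  -- A lift of `w` to `Z ⊗ R^Z` involves finitely many `ζ j`; its `z`-th component writes every `z`
  -- as a combination of them.
  obtain ⟨y, hy⟩ := (tensorMap_exact_left (Z → R) (LinearMap.exact_subtype_ker_map g) hg w).1 hw
  obtain ⟨n, ζ, f, rfl⟩ := tensor_exists_sum y
  have hspan : Submodule.span Rᵐᵒᵖ (Set.range fun j => (ζ j).1) = Z := by
    apply le_antisymm
    · rw [Submodule.span_le]
      rintro _ ⟨j, rfl⟩
      exact (ζ j).2
    · intro z hz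
      have h1 := congrArg (fun t => tensorSelfHom R _ (tensorMap R LinearMap.id
        (LinearMap.proj (R := R) (φ := fun _ => R) (⟨z, hz⟩ : Z)) t)) hy
      simp only [w, map_sum, tensorMap_tmul, tensorSelfHom_tmul] at h1
      have h2 : z = ∑ j, MulOpposite.op (f j ⟨z, hz⟩) • (ζ j).1 := by
        refine Eq.trans ?_ h1.symm
        exact (hsum z).symm
      rw [h2]
      exact Submodule.sum_mem _ fun j _ => Submodule.smul_mem _ _ (Submodule.subset_span ⟨j, rfl⟩)
  rw [show LinearMap.ker g = Z from rfl, ← hspan]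
  exact Submodule.fg_span (Set.finite_range _)

end Chase

/-! ### Reduction to free modules of finite rank. -/

section FiniteRestriction

/-- A finite subset of a free module lies in a free direct summand of finite rank. -/
theorem exists_finite_free_summand {S L : Type*} [Ring S] [AddCommGroup L] [Module S L]
    [Module.Free S L] (s : Finset L) :
    ∃ (n : ℕ) (e : (Fin n → S) →ₗ[S] L) (r : L →ₗ[S] (Fin n → S)), r ∘ₗ e = LinearMap.id ∧
      ∀ x ∈ s, e (r x) = x := by
  classical
  let b := Module.Free.chooseBasis S L
  let J := s.biUnion fun x => (b.repr x).support
  let φ := J.equivFin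
  let e := Fintype.linearCombination S fun k => b (φ.symm k)
  let r : L →ₗ[S] (Fin J.card → S) := LinearMap.pi fun k => b.coord (φ.symm k)
  refine ⟨J.card, e, r, ?_, ?_⟩
  · ext k l
    simp [e, r, Fintype.linearCombination_apply, Pi.single_apply, Finsupp.single_apply]
    simp [eq_comm]
  · intro x hx
    have hsub : (b.repr x).support ⊆ J := Finset.subset_biUnion_of_mem
      (fun x => (b.repr x).support) hx
    calc e (r x) = ∑ k, b.repr x (φ.symm k) • b (φ.symm k) := by
          simp [e, r, Fintype.linearCombination_apply]
      _ = ∑ j : J, b.repr x j • b j := Equiv.sum_comp φ.symm fun j : J => b.repr x j • b j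
      _ = ∑ j ∈ J, b.repr x j • b j := Finset.sum_coe_sort J fun j => b.repr x j • b j
      _ = (b.repr x).sum fun j c => c • b j :=
          (Finsupp.sum_of_support_subset _ hsub (fun j c => c • b j) fun _ _ => zero_smul _ _).symm
      _ = x := b.linearCombination_repr x

/-- A linear map of free modules restricts to free direct summands of finite rank containing given
finite sets. -/
theorem exists_finite_free_restriction {S A B : Type*} [Ring S] [AddCommGroup A] [Module S A]
    [AddCommGroup B] [Module S B] [Module.Free S A] [Module.Free S B] (d : A →ₗ[S] B)
    (s : Finset A) (t : Finset B) :
    ∃ (n m : ℕ) (e : (Fin n → S) →ₗ[S] A) (r : A →ₗ[S] (Fin n → S)) (e' : (Fin m → S) →ₗ[S] B)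
      (r' : B →ₗ[S] (Fin m → S)) (d' : (Fin n → S) →ₗ[S] (Fin m → S)),
      r ∘ₗ e = LinearMap.id ∧ r' ∘ₗ e' = LinearMap.id ∧ e' ∘ₗ d' = d ∘ₗ e ∧
      (∀ x ∈ s, e (r x) = x) ∧ ∀ x ∈ t, e' (r' x) = x := by
  classical
  obtain ⟨n, e, r, hre, hs⟩ := exists_finite_free_summand (S := S) s
  -- Including the images of the basis vectors in the finite set makes `d` map the first summand
  -- into the second.
  obtain ⟨m, e', r', hre', ht⟩ := exists_finite_free_summand (S := S)
    (t ∪ Finset.univ.image fun k => d (e (Pi.single k 1)))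
  refine ⟨n, m, e, r, e', r', r' ∘ₗ d ∘ₗ e, hre, hre', ?_, hs,
    fun x hx => ht x (Finset.mem_union_left _ hx)⟩
  apply LinearMap.pi_ext'
  intro k
  ext
  exact ht _ (Finset.mem_union_right _ (Finset.mem_image_of_mem _ (Finset.mem_univ k)))

/-- An injection of projective modules extends, up to direct summands, to an injection of free
modules. -/
theorem exists_free_injection {S K F : Type u} [Ring S] [AddCommGroup K] [Module S K]
    [AddCommGroup F] [Module S F] [Module.Projective S K] (i : K →ₗ[S] F)
    (hi : Function.Injective i) :
    ∃ (s : K →ₗ[S] (K →₀ S)) (r : (K →₀ S) →ₗ[S] K) (d : (K →₀ S) →ₗ[S] F × (K →₀ S)),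
      r ∘ₗ s = LinearMap.id ∧ Function.Injective d ∧ d ∘ₗ s = LinearMap.inl S _ _ ∘ₗ i ∧
      LinearMap.fst S _ _ ∘ₗ d = i ∘ₗ r := by
  obtain ⟨s, hs⟩ := Module.projective_def'.1 ‹Module.Projective S K›
  let r : (K →₀ S) →ₗ[S] K := Finsupp.linearCombination S id
  have hs' : ∀ k, r (s k) = k := LinearMap.congr_fun hs
  -- The first component sees only the retract `K`; the second keeps the complement `ker r`, so
  -- nothing is lost.
  refine ⟨s, r, LinearMap.prod (i ∘ₗ r) (LinearMap.id - s ∘ₗ r), hs, ?_, ?_, ?_⟩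
  · rw [injective_iff_map_eq_zero]
    intro a ha
    have h1 : r a = 0 := (map_eq_zero_iff i hi).1 (congrArg Prod.fst ha)
    have h2 : a - s (r a) = 0 := congrArg Prod.snd ha
    rwa [h1, map_zero, sub_zero] at h2
  · ext k : 1
    simp [hs']
  · rfl

end FiniteRestriction

/-! ### Finitely presented modules test `P1`-flatness. -/

section P1fpFlat

variable {R : Type u} [Ring R]

theorem P1fp_coker {m n : ℕ} {d : (Fin n → Rᵐᵒᵖ) →ₗ[Rᵐᵒᵖ] (Fin m → Rᵐᵒᵖ)}
    (hd : Function.Injective d) :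
    P1fp R (ModuleCat.of Rᵐᵒᵖ ((Fin m → Rᵐᵒᵖ) ⧸ LinearMap.range d)) := by
  constructor
  · exact (P1_iff_projective (K := ModuleCat.of Rᵐᵒᵖ (Fin n → Rᵐᵒᵖ))
      (F := ModuleCat.of Rᵐᵒᵖ (Fin m → Rᵐᵒᵖ)) (i := d) (p := (LinearMap.range d).mkQ) hd
      (by rw [LinearMap.exact_iff, Submodule.ker_mkQ]) (Submodule.mkQ_surjective _)).2
      (inferInstanceAs (Module.Projective Rᵐᵒᵖ (Fin n → Rᵐᵒᵖ)))
  · have := Module.finitePresentation_of_projective Rᵐᵒᵖ (Fin m → Rᵐᵒᵖ)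
    refine Module.finitePresentation_of_surjective _ (Submodule.mkQ_surjective _) ?_
    rw [Submodule.ker_mkQ, LinearMap.range_eq_map]
    exact Module.Finite.fg_top.map d

/-- A tensor is a finite sum of pure tensors, so only finitely many elements of `A` matter. -/
theorem exists_finset_tensor {A B : Type u} [AddCommGroup A] [Module Rᵐᵒᵖ A] [AddCommGroup B]
    [Module R B] (t : Tensor R A B) :
    ∃ s : Finset A, ∀ f : A →ₗ[Rᵐᵒᵖ] A, (∀ a ∈ s, f a = a) →
      tensorMap R f LinearMap.id t = t := by
  classical
  induction t using tensor_induction with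
  | zero => exact ⟨∅, fun _ _ => map_zero _⟩
  | tmul a b => exact ⟨{a}, fun f hf => by
      rw [tensorMap_tmul, hf a (Finset.mem_singleton_self a), LinearMap.id_apply]⟩
  | add x y hx hy =>
    obtain ⟨s, hs⟩ := hx
    obtain ⟨s', hs'⟩ := hy
    exact ⟨s ∪ s', fun f hf => by
      rw [map_add, hs f fun a ha => hf a (Finset.mem_union_left _ ha),
        hs' f fun a ha => hf a (Finset.mem_union_right _ ha)]⟩

/-- A kernel element already lives over a free summand of finite rank. There the restricted
injection has cokernel in `P1fp`; projective modules are handled as retracts of free ones. -/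
theorem P1Flat_of_P1fpFlat {M : ModuleCat.{u} R} (hM : rightTorOrth (P1fp R) M) : P1Flat R M := by
  have hfin : ∀ {m n : ℕ} {d : (Fin n → Rᵐᵒᵖ) →ₗ[Rᵐᵒᵖ] (Fin m → Rᵐᵒᵖ)},
      Function.Injective d → Function.Injective (tensorMap R d (LinearMap.id : M →ₗ[R] M)) :=
    fun {m n d} hd => (isZero_tor_iff_injective (K := ModuleCat.of Rᵐᵒᵖ (Fin n → Rᵐᵒᵖ))
      (F := ModuleCat.of Rᵐᵒᵖ (Fin m → Rᵐᵒᵖ)) (i := d) (p := (LinearMap.range d).mkQ)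
      (H := ModuleCat.of Rᵐᵒᵖ ((Fin m → Rᵐᵒᵖ) ⧸ LinearMap.range d))
      isFlatRight_of_projective hd (by rw [LinearMap.exact_iff, Submodule.ker_mkQ])
      (Submodule.mkQ_surjective _) M).1 (hM _ (P1fp_coker hd))
  have hfree : ∀ {A B : Type u} [AddCommGroup A] [AddCommGroup B] [Module Rᵐᵒᵖ A] [Module Rᵐᵒᵖ B]
      [Module.Free Rᵐᵒᵖ A] [Module.Free Rᵐᵒᵖ B] {d : A →ₗ[Rᵐᵒᵖ] B}, Function.Injective d →
      Function.Injective (tensorMap R d (LinearMap.id : M →ₗ[R] M)) := by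
    intro A B _ _ _ _ _ _ d hd
    rw [injective_iff_map_eq_zero]
    intro t ht
    obtain ⟨s, hs⟩ := exists_finset_tensor t
    obtain ⟨n, m, e, r, e', r', d', hre, hre', hcomm, hse, -⟩ :=
      exists_finite_free_restriction d s ∅
    have hd' : Function.Injective d' := by
      have h1 : Function.Injective (d ∘ₗ e) :=
        hd.comp (Function.LeftInverse.injective (LinearMap.congr_fun hre))
      rw [← hcomm] at h1
      exact Function.Injective.of_comp h1
    rw [← hs (e ∘ₗ r) hse, tensorMap_comp_left]
    rw [← hs (e ∘ₗ r) hse, ← tensorMap_comp_left, ← LinearMap.comp_assoc, ← hcomm,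
      LinearMap.comp_assoc, tensorMap_comp_left, tensorMap_comp_left] at ht
    have h0 := (injective_iff_map_eq_zero _).1 (hfin hd') _ ((injective_iff_map_eq_zero _).1
      (tensorMap_injective_of_leftInverse (R := R) M hre') _ ht)
    rw [h0, map_zero]
  rw [P1Flat_iff]
  intro K F i hK hF hi
  obtain ⟨sF, hsF⟩ := Module.projective_def'.1 hF
  have hsF' : Function.Injective sF :=
    Function.LeftInverse.injective (g := Finsupp.linearCombination Rᵐᵒᵖ id) (LinearMap.congr_fun hsF)
  obtain ⟨s, r, d, hrs, hd, hds, -⟩ := exists_free_injection (sF ∘ₗ i) (hsF'.comp hi)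
  have h1 := (hfree hd).comp (tensorMap_injective_of_leftInverse (R := R) M hrs)
  rw [injective_iff_map_eq_zero]
  intro x hx
  apply h1
  simp only [Function.comp_apply, map_zero]
  rw [← tensorMap_comp_left, hds, ← LinearMap.comp_assoc, tensorMap_comp_left, hx, map_zero]

end P1fpFlat

/-! ### Embedding powers of the ring in a double character module. -/

noncomputable section PowerEmbedding

variable {R : Type u} [Ring R]

/-- The inclusion of a direct sum of copies of `C` into the product is pure. -/
theorem tensorMap_lcoeFun_injective (I : Type u) (C X : Type u) [AddCommGroup C] [Module Rᵐᵒᵖ C]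
    [AddCommGroup X] [Module R X] : Function.Injective (tensorMap R
      (Finsupp.lcoeFun : (I →₀ C) →ₗ[Rᵐᵒᵖ] (I → C)) (LinearMap.id : X →ₗ[R] X)) := by
  classical
  rw [injective_iff_map_eq_zero]
  intro t ht
  obtain ⟨s, hs⟩ := exists_finset_tensor t
  let J := s.biUnion fun x => x.support
  -- Truncation to `J`: a retraction on the finitely many elements that occur in the tensor.
  let ρ : (I → C) →ₗ[Rᵐᵒᵖ] (I →₀ C) :=
    ∑ j ∈ J, Finsupp.lsingle j ∘ₗ LinearMap.proj (φ := fun _ => C) j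
  rw [← hs (ρ ∘ₗ Finsupp.lcoeFun), tensorMap_comp_left, ht, map_zero]
  intro a ha
  have hsub : a.support ⊆ J := Finset.subset_biUnion_of_mem (fun x : I →₀ C => x.support) ha
  calc (ρ ∘ₗ Finsupp.lcoeFun) a = ∑ j ∈ J, Finsupp.single j (a j) := by
        simp [ρ]
    _ = a.sum Finsupp.single :=
        (Finsupp.sum_of_support_subset _ hsub _ fun _ _ => Finsupp.single_zero _).symm
    _ = a := a.sum_single

/-- The identification of the underlying group of `M⁺`. -/
def charOfLeftHom (M : ModuleCat.{u} R) : charOfLeft M →+ (M →+ AddCircle (1 : ℚ)) :=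
  AddMonoidHom.id (M →+ AddCircle (1 : ℚ))

theorem charOfLeftHom_smul {M : ModuleCat.{u} R} (r : Rᵐᵒᵖ) (χ : charOfLeft M) (m : M) :
    charOfLeftHom M (r • χ) m = charOfLeftHom M χ (r.unop • m) := rfl

/-- The power `R^I` embeds in the bidual of the direct sum `R^(I)`. -/
theorem exists_injective_pi_doubleChar (I : Type u) :
    ∃ f : (I → R) →ₗ[R] doubleChar (ModuleCat.of R (I →₀ R)), Function.Injective f := by
  classical
  let C := charOfLeft (ModuleCat.of R R)
  let N := charOfLeft (ModuleCat.of R (I →₀ R))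
  -- The pairing `(c, f) ↦ ∑ c_i(f_i)`, which makes sense only for finite support. Purity of the
  -- direct sum in the product and divisibility of `ℚ/ℤ` extend it to `C^I ⊗ R^I`.
  let φ₀ : Tensor R (I →₀ C) (I → R) →+ AddCircle (1 : ℚ) :=
    tensorLift (Finsupp.liftAddHom fun i => AddMonoidHom.mk' (fun c : C =>
        (charOfLeftHom (ModuleCat.of R R) c).comp (Pi.evalAddMonoidHom (fun _ => R) i))
          fun c c' => rfl)
      (fun x r b => by
        induction x using Finsupp.induction_linear with
        | zero => rw [smul_zero, map_zero, AddMonoidHom.zero_apply, AddMonoidHom.zero_apply]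
        | add x y hx hy => simp only [smul_add, map_add, AddMonoidHom.add_apply, hx, hy]
        | single j s =>
          rw [Finsupp.smul_single, Finsupp.liftAddHom_apply_single,
            Finsupp.liftAddHom_apply_single]
          rfl)
  have hφ₀ : ∀ i (c : C) (f : I → R), φ₀ (tmul R (Finsupp.single i c) f) =
      charOfLeftHom (ModuleCat.of R R) c (f i) := by
    intro i c f
    rw [tensorLift_tmul, Finsupp.liftAddHom_apply_single]
    rfl
  obtain ⟨φ, hφ⟩ := exists_character_extension _ (tensorMap_lcoeFun_injective (R := R) I C (I → R))
    φ₀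
  let μ : N →ₗ[Rᵐᵒᵖ] (I → C) :=
    { toFun := fun χ i => (charOfLeftHom _ χ).comp (Finsupp.singleAddHom (M := R) i)
      map_add' := fun χ χ' => rfl
      map_smul' := fun r χ => by
        funext i
        refine AddMonoidHom.ext (M := R) fun m => ?_
        refine (charOfLeftHom_smul r χ (Finsupp.single i m)).trans ?_
        rw [Finsupp.smul_single]
        rfl }
  have hμ : ∀ i (c : C), ∃ χ : N, μ χ = Finsupp.single i c := by
    intro i c
    refine ⟨(charOfLeftHom (ModuleCat.of R R) c).comp (Finsupp.applyAddHom (M := R) i),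
      funext fun j => AddMonoidHom.ext (M := R) fun m => ?_⟩
    change charOfLeftHom (ModuleCat.of R R) c (Finsupp.single j m i) =
      charOfLeftHom (ModuleCat.of R R) (Finsupp.single i c j) m
    by_cases hij : i = j
    · subst hij
      rw [Finsupp.single_eq_same, Finsupp.single_eq_same]
    · rw [Finsupp.single_eq_of_ne hij, Finsupp.single_eq_of_ne' hij, map_zero, map_zero]
      rfl
  -- The adjoint of the extended pairing, with characters of `R^(I)` read as families in `C^I` by
  -- `μ`. Families concentrated at one index show injectivity.
  let f : (I → R) →ₗ[R] doubleChar (ModuleCat.of R (I →₀ R)) :=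
    { toFun := fun x => φ.comp ((tmulLeft x).comp μ.toAddMonoidHom)
      map_add' := fun x y => AddMonoidHom.ext (M := N) fun χ =>
        (congrArg φ (tmul_add (μ χ) x y)).trans (map_add φ _ _)
      map_smul' := fun r x => AddMonoidHom.ext (M := N) fun χ =>
        (congrArg φ (smul_tmul r (μ χ) x)).symm.trans
          (congrArg (fun y => φ (tmul R y x)) (map_smul μ (MulOpposite.op r) χ).symm) }
  refine ⟨f, (injective_iff_map_eq_zero _).2 fun x hx => ?_⟩
  funext i
  refine eq_zero_of_character fun c => ?_
  obtain ⟨χ, hχ⟩ := hμ i c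
  have h1 : φ (tmul R (μ χ) x) = 0 :=
    DFunLike.congr_fun (F := N →+ AddCircle (1 : ℚ)) hx χ
  rw [hχ] at h1
  refine (hφ₀ i c x).symm.trans ?_
  rw [← hφ]
  exact h1

end PowerEmbedding

/-! ### Lenzing's criterion for direct limits. -/

section DirectLimits

variable {S : Type u} [Ring S]

theorem exists_descend {A B Y : Type*} [AddCommGroup A] [Module S A] [AddCommGroup B] [Module S B]
    [AddCommGroup Y] [Module S Y] {q : A →ₗ[S] B} (hq : Function.Surjective q) (w : A →ₗ[S] Y)
    (h : LinearMap.ker q ≤ LinearMap.ker w) : ∃ w' : B →ₗ[S] Y, w' ∘ₗ q = w := by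
  refine ⟨(LinearMap.ker q).liftQ w h ∘ₗ (q.quotKerEquivOfSurjective hq).symm.toLinearMap, ?_⟩
  ext x
  have : (q.quotKerEquivOfSurjective hq).symm (q x) = (LinearMap.ker q).mkQ x := by
    rw [LinearEquiv.symm_apply_eq]
    rfl
  rw [LinearMap.comp_apply, LinearMap.comp_apply, LinearEquiv.coe_coe, this, Submodule.mkQ_apply,
    Submodule.liftQ_apply]

/-- A map from a finitely presented module to a direct limit factors through a stage. -/
theorem exists_factor_directLimit {I : Type u} [Preorder I] [Nonempty I] [IsDirectedOrder I]
    [DecidableEq I] {G : I → ModuleCat.{u} S} {f : ∀ i j, i ≤ j → G i →ₗ[S] G j}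
    [DirectedSystem (fun i => G i) (fun i j h => f i j h)] {X : Type u} [AddCommGroup X]
    [Module S X] [Module.FinitePresentation S X]
    (g : X →ₗ[S] Module.DirectLimit (fun i => G i) f) :
    ∃ (i : I) (g' : X →ₗ[S] G i), Module.DirectLimit.of S I (fun i => G i) f i ∘ₗ g' = g := by
  obtain ⟨n, m, q, d, hq, hd⟩ := Module.FinitePresentation.exists_fin' S X
  choose i x hx using fun k : Fin n => Module.DirectLimit.exists_of (g (q (Pi.single k 1)))
  obtain ⟨i₀, hi₀⟩ := Finite.exists_le i
  let v : (Fin n → S) →ₗ[S] G i₀ := Fintype.linearCombination S fun k => f _ _ (hi₀ k) (x k)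
  have hv : Module.DirectLimit.of S I (fun i => G i) f i₀ ∘ₗ v = g ∘ₗ q := by
    apply LinearMap.pi_ext'
    intro k
    ext
    simp only [v, LinearMap.comp_apply, LinearMap.single_apply,
      Fintype.linearCombination_apply_single, one_smul, Module.DirectLimit.of_f, hx]
  have hz : ∀ l : Fin m, Module.DirectLimit.of S I (fun i => G i) f i₀
      (v (d (Pi.single l 1))) = 0 := by
    intro l
    have := LinearMap.congr_fun hv (d (Pi.single l 1))
    rw [LinearMap.comp_apply, LinearMap.comp_apply, hd.apply_apply_eq_zero, map_zero] at this
    exact this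
  -- The finitely many relations vanish in the limit, hence all vanish at one later stage, where the
  -- map descends to `X`.
  choose j hij hj using fun l => Module.DirectLimit.of.zero_exact (hz l)
  obtain ⟨j₁, hj₁⟩ := Finite.exists_le j
  obtain ⟨j₀, hij₀, hjj₀⟩ := exists_ge_ge i₀ j₁
  have hker : LinearMap.ker q ≤ LinearMap.ker (f i₀ j₀ hij₀ ∘ₗ v) := by
    rw [hd.linearMap_ker_eq, LinearMap.range_le_ker_iff]
    apply LinearMap.pi_ext'
    intro l
    ext
    have h1 := DirectedSystem.map_map (f := fun i j h => f i j h) (hij l) ((hj₁ l).trans hjj₀)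
      (v (d (Pi.single l 1)))
    rw [hj l, map_zero] at h1
    exact h1.symm
  obtain ⟨g', hg'⟩ := exists_descend hq _ hker
  refine ⟨j₀, g', ?_⟩
  rw [← LinearMap.cancel_right hq, LinearMap.comp_assoc, hg', ← hv]
  ext x
  exact Module.DirectLimit.of_f

section Lenzing

variable {C : ObjectProperty (ModuleCat.{u} S)} {M : Type u} [AddCommGroup M] [Module S M]

variable {B : Type u} [AddCommGroup B] [Module S B] {π : B →ₗ[S] M}

variable (C π) in
/-- Pairs of finitely generated submodules `N ≤ P` of the source of `π`, with `N` consisting of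
elements of the kernel of `π`, such that `P ⧸ N` lies in the class `C`. -/
structure Approximation where
  /-- The generators. -/
  gen : Submodule S B
  /-- The relations. -/
  rel : Submodule S B
  gen_fg : gen.FG
  rel_fg : rel.FG
  rel_le : rel ≤ LinearMap.ker π
  mem : C (ModuleCat.of S (gen ⧸ rel.comap gen.subtype))

instance : Preorder (Approximation C π) where
  le p q := p.gen ≤ q.gen ∧ p.rel ≤ q.rel
  le_refl _ := ⟨le_rfl, le_rfl⟩
  le_trans _ _ _ h h' := ⟨h.1.trans h'.1, h.2.trans h'.2⟩

/-- The quotient of `P` by `P ⊓ ker ρ` is `Y`, whose finite presentation makes these relations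
finitely generated; agreement of `b ∘ₗ ρ` with `π` on `P` puts them in `ker π`. -/
theorem Approximation.exists_of_surjective
    (hiso : ∀ {X Y : ModuleCat.{u} S}, (X ≃ₗ[S] Y) → C X → C Y)
    (hfp : ∀ {X : ModuleCat.{u} S}, C X → Module.FinitePresentation S X)
    {Y : ModuleCat.{u} S} (hY : C Y) (ρ : B →ₗ[S] Y) (b : Y →ₗ[S] M) {P : Submodule S B}
    (hP : P.FG) (hbρ : Set.EqOn (b ∘ₗ ρ) π P) (hρ : ∀ y, ∃ x ∈ P, ρ x = y) :
    ∃ p : Approximation C π, p.gen = P ∧ p.rel = P ⊓ LinearMap.ker ρ := by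
  let ρP : P →ₗ[S] Y := ρ ∘ₗ P.subtype
  have hρP : Function.Surjective ρP := fun y =>
    let ⟨x, hx, hxy⟩ := hρ y
    ⟨⟨x, hx⟩, hxy⟩
  have : Module.Finite S P := Module.Finite.iff_fg.2 hP
  have := hfp hY
  have hN : (P ⊓ LinearMap.ker ρ).comap P.subtype = LinearMap.ker ρP := by
    ext x
    simp [ρP]
  have hN' : P ⊓ LinearMap.ker ρ = (LinearMap.ker ρP).map P.subtype := by
    rw [← hN, Submodule.map_comap_subtype, ← inf_assoc, inf_idem]
  refine ⟨⟨P, P ⊓ LinearMap.ker ρ, hP, ?_, ?_, ?_⟩, rfl, rfl⟩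
  · rw [hN']
    exact (Module.FinitePresentation.fg_ker ρP hρP).map _
  · rintro x ⟨hx, hx'⟩
    exact (hbρ hx).symm.trans ((congrArg b hx').trans (map_zero b))
  · exact hiso ((Submodule.quotEquivOfEq _ _ hN).trans
      (ρP.quotKerEquivOfSurjective hρP)).symm hY

/-- If every finite set of elements and relations is captured by an approximation, then the target
of `π` is the direct limit of the approximations. -/
theorem dirLim_of_approximation (hπ : Function.Surjective π)
    (hex : ∀ s t : Finset B, (∀ x ∈ t, π x = 0) →
      ∃ p : Approximation C π, (∀ x ∈ s, x ∈ p.gen) ∧ ∀ x ∈ t, x ∈ p.rel) :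
    dirLim C (ModuleCat.of S M) := by
  classical
  have hdir : IsDirectedOrder (Approximation C π) := ⟨fun p q => by
    obtain ⟨s, hs⟩ := p.gen_fg
    obtain ⟨s', hs'⟩ := q.gen_fg
    obtain ⟨t, ht⟩ := p.rel_fg
    obtain ⟨t', ht'⟩ := q.rel_fg
    obtain ⟨r, hr, hr'⟩ := hex (s ∪ s') (t ∪ t') (fun x hx => by
      rcases Finset.mem_union.1 hx with hx | hx
      · exact p.rel_le (ht ▸ Submodule.subset_span hx)
      · exact q.rel_le (ht' ▸ Submodule.subset_span hx))
    refine ⟨r, ⟨?_, ?_⟩, ⟨?_, ?_⟩⟩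
    · rw [← hs, Submodule.span_le]
      exact fun x hx => hr x (Finset.mem_union_left _ hx)
    · rw [← ht, Submodule.span_le]
      exact fun x hx => hr' x (Finset.mem_union_left _ hx)
    · rw [← hs', Submodule.span_le]
      exact fun x hx => hr x (Finset.mem_union_right _ hx)
    · rw [← ht', Submodule.span_le]
      exact fun x hx => hr' x (Finset.mem_union_right _ hx)⟩
  have hne : Nonempty (Approximation C π) :=
    let ⟨p, _⟩ := hex ∅ ∅ (by simp); ⟨p⟩
  let G : Approximation C π → ModuleCat.{u} S := fun p =>
    ModuleCat.of S (p.gen ⧸ p.rel.comap p.gen.subtype)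
  let f : ∀ p q : Approximation C π, p ≤ q → G p →ₗ[S] G q := fun p q hpq =>
    Submodule.mapQ _ _ (Submodule.inclusion hpq.1) fun x hx => hpq.2 hx
  have hsys : DirectedSystem (fun p => G p) (fun p q hpq => f p q hpq) :=
    { map_self := fun p x => by
        obtain ⟨x, rfl⟩ := Submodule.mkQ_surjective _ x
        rfl
      map_map := fun p q r hpq hqr x => by
        obtain ⟨x, rfl⟩ := Submodule.mkQ_surjective _ x
        rfl }
  refine ⟨Approximation C π, inferInstance, hne, hdir, G, f, hsys, fun p => p.mem, ⟨?_⟩⟩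
  let g : ∀ p, G p →ₗ[S] M := fun p => Submodule.liftQ _ (π ∘ₗ p.gen.subtype) fun x hx =>
    p.rel_le hx
  have hg : ∀ p q hpq x, g q (f p q hpq x) = g p x := fun p q hpq x => by
    obtain ⟨x, rfl⟩ := Submodule.mkQ_surjective _ x
    rfl
  refine (LinearEquiv.ofBijective (Module.DirectLimit.lift S _ (fun p => G p) f g hg) ⟨?_, ?_⟩).symm
  · rw [injective_iff_map_eq_zero]
    intro z hz
    obtain ⟨p, x, rfl⟩ := Module.DirectLimit.exists_of z
    rw [Module.DirectLimit.lift_of] at hz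
    obtain ⟨x, rfl⟩ := Submodule.mkQ_surjective _ x
    have hx : π x.1 = 0 := hz
    -- An element of the kernel is a relation in some approximation, so it dies at a common upper
    -- bound.
    obtain ⟨q, -, hq⟩ := hex ∅ {x.1} (by simpa using hx)
    obtain ⟨r, hpr, hqr⟩ := exists_ge_ge p q
    rw [← Module.DirectLimit.of_f (hij := hpr)]
    refine Eq.trans (congrArg _ ?_) (map_zero (Module.DirectLimit.of S _ (fun p => G p) f r))
    exact (Submodule.Quotient.mk_eq_zero _).2 (hqr.2 (hq x.1 (Finset.mem_singleton_self _)))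
  · intro m
    obtain ⟨x, rfl⟩ := hπ m
    obtain ⟨p, hp, -⟩ := hex {x} ∅ (by simp)
    refine ⟨Module.DirectLimit.of S _ (fun p => G p) f p
      (Submodule.mkQ _ ⟨x, hp _ (Finset.mem_singleton_self _)⟩), ?_⟩
    rw [Module.DirectLimit.lift_of]
    rfl

/-- The given elements and relations define a map from a finitely presented module, which factors
through some `Y` in `C`. Indexing by `M × ℕ` repeats each element of `M` infinitely often, leaving
unused basis vectors to cover the generators of `Y`. -/
theorem Approximation.exists_of_finite
    (hiso : ∀ {X Y : ModuleCat.{u} S}, (X ≃ₗ[S] Y) → C X → C Y)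
    (hfp : ∀ {X : ModuleCat.{u} S}, C X → Module.FinitePresentation S X)
    (h : ∀ (X : ModuleCat.{u} S) (g : X →ₗ[S] M), Module.FinitePresentation S X →
      ∃ (Y : ModuleCat.{u} S) (a : X →ₗ[S] Y) (b : Y →ₗ[S] M), C Y ∧ b ∘ₗ a = g)
    (s t : Finset (M × ℕ →₀ S))
    (ht : ∀ x ∈ t, Finsupp.linearCombination S (Prod.fst : M × ℕ → M) x = 0) :
    ∃ p : Approximation C (Finsupp.linearCombination S (Prod.fst : M × ℕ → M)),
      (∀ x ∈ s, x ∈ p.gen) ∧ ∀ x ∈ t, x ∈ p.rel := by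
  classical
  let π := Finsupp.linearCombination S (Prod.fst : M × ℕ → M)
  let J := (s ∪ t).biUnion fun x => x.support
  have hJ : ∀ x ∈ s ∪ t, (x.support : Set (M × ℕ)) ⊆ J := fun x hx =>
    Finset.coe_subset.2 (Finset.subset_biUnion_of_mem (fun x : M × ℕ →₀ S => x.support) hx)
  let res : (M × ℕ →₀ S) →ₗ[S] (J →₀ S) := Finsupp.lsubtypeDomain (J : Set (M × ℕ))
  let inc : (J →₀ S) →ₗ[S] (M × ℕ →₀ S) := Finsupp.lmapDomain S S Subtype.val
  have hres : ∀ x ∈ s ∪ t, inc (res x) = x := by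
    intro x hx
    ext y
    by_cases hy : y ∈ J
    · exact Finsupp.mapDomain_apply Subtype.val_injective (res x) ⟨y, hy⟩
    · refine (Finsupp.mapDomain_of_notMem_range (res x) y (by simpa using hy)).trans ?_
      exact (Finsupp.notMem_support_iff.1 fun hyx => hy (hJ x hx hyx)).symm
  let N₀ := Submodule.span S (res '' t)
  have hN₀ : N₀ ≤ LinearMap.ker (π ∘ₗ inc) := by
    rw [Submodule.span_le]
    rintro _ ⟨x, hx, rfl⟩
    rw [SetLike.mem_coe, LinearMap.mem_ker, LinearMap.comp_apply,
      hres x (Finset.mem_union_right _ hx)]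
    exact ht x hx
  have : Module.FinitePresentation S (J →₀ S) := Module.finitePresentation_of_projective S _
  have hX : Module.FinitePresentation S ((J →₀ S) ⧸ N₀) :=
    Module.finitePresentation_of_surjective N₀.mkQ N₀.mkQ_surjective (by
      rw [N₀.ker_mkQ]
      exact Submodule.fg_span (t.finite_toSet.image res))
  obtain ⟨Y, a, b, hY, hab⟩ := h (ModuleCat.of S ((J →₀ S) ⧸ N₀)) (N₀.liftQ (π ∘ₗ inc) hN₀) hX
  have := hfp hY
  obtain ⟨k, c, hc⟩ := Module.Finite.exists_fin' S Y
  obtain ⟨n₀, hn₀⟩ : ∃ n₀, ∀ x ∈ J, x.2 < n₀ :=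
    ⟨J.sup (fun x => x.2 + 1), fun x hx => Finset.le_sup (f := fun x => x.2 + 1) hx⟩
  -- The first entry makes `π` agree with `b ∘ₗ ρ` on the new basis vectors; the second, beyond
  -- `n₀`, makes them distinct and disjoint from `J`.
  let e : Fin k → M × ℕ := fun j => (b (c (Pi.single j 1)), n₀ + j)
  have he : Function.Injective e := fun j j' hjj => by
    have : n₀ + j.1 = n₀ + j'.1 := congrArg Prod.snd hjj
    exact Fin.ext (by omega)
  have heJ : ∀ j, e j ∉ J := fun j hj => by
    have : n₀ + j.1 < n₀ := hn₀ _ hj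
    omega
  let ρ : (M × ℕ →₀ S) →ₗ[S] Y := Finsupp.linearCombination S (Function.extend e
    (fun j => c (Pi.single j 1)) fun x => a (N₀.mkQ (res (Finsupp.single x 1))))
  have hρe : ∀ j, ρ (Finsupp.single (e j) 1) = c (Pi.single j 1) := fun j => by
    rw [Finsupp.linearCombination_single, one_smul, he.extend_apply]
  have hρJ : ∀ x ∈ J, ρ (Finsupp.single x 1) = a (N₀.mkQ (res (Finsupp.single x 1))) := by
    intro x hx
    rw [Finsupp.linearCombination_single, one_smul, Function.extend_apply']
    rintro ⟨j, rfl⟩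
    exact heJ j hx
  have hinc : ∀ x : J, inc (Finsupp.single x 1) = Finsupp.single x.1 1 := fun x =>
    Finsupp.mapDomain_single
  have hresinc : ∀ x, res (inc x) = x := by
    intro x
    ext y
    exact Finsupp.mapDomain_apply Subtype.val_injective x y
  have hρinc : ρ ∘ₗ inc = a ∘ₗ N₀.mkQ := by
    ext x : 1
    ext
    change ρ (inc (Finsupp.single x 1)) = a (N₀.mkQ (Finsupp.single x 1))
    rw [hinc, hρJ x x.2, ← hinc, hresinc]
  have hbρinc : b ∘ₗ ρ ∘ₗ inc = π ∘ₗ inc := by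
    rw [hρinc, ← LinearMap.comp_assoc, hab]
    exact N₀.liftQ_mkQ _ _
  let P := Finsupp.supported S S ((J : Set (M × ℕ)) ∪ Set.range e)
  have hP : P = Submodule.span S ((fun i => Finsupp.single i 1) '' ((J : Set (M × ℕ)) ∪
    Set.range e)) := Finsupp.supported_eq_span_single S _
  have hPfg : P.FG := by
    rw [hP]
    exact Submodule.fg_span ((J.finite_toSet.union (Set.finite_range e)).image _)
  have hbρ : Set.EqOn (b ∘ₗ ρ) π P := by
    rw [hP]
    apply LinearMap.eqOn_span'
    rintro _ ⟨x, hx | ⟨j, rfl⟩, rfl⟩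
    · have := LinearMap.congr_fun hbρinc (Finsupp.single ⟨x, hx⟩ 1)
      simp only [LinearMap.comp_apply, hinc] at this
      exact this
    · simp only [LinearMap.comp_apply, hρe, π, Finsupp.linearCombination_single, one_smul, e]
  have hρ : ∀ y, ∃ x ∈ P, ρ x = y := by
    intro y
    obtain ⟨x, rfl⟩ := hc y
    refine ⟨∑ j, x j • Finsupp.single (e j) 1, P.sum_mem fun j _ => P.smul_mem _ ?_, ?_⟩
    · exact Finsupp.single_mem_supported S 1 (Or.inr ⟨j, rfl⟩)
    · simp_rw [map_sum, map_smul, hρe, ← map_smul]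
      rw [← map_sum]
      congr 1
      ext j
      simp [Finset.sum_apply, Pi.single_apply]
  obtain ⟨p, hp, hp'⟩ := Approximation.exists_of_surjective hiso hfp hY ρ b hPfg hbρ hρ
  refine ⟨p, fun x hx => ?_, fun x hx => ?_⟩
  · rw [hp]
    exact (Finsupp.mem_supported S x).2
      ((hJ x (Finset.mem_union_left _ hx)).trans Set.subset_union_left)
  · rw [hp']
    refine ⟨(Finsupp.mem_supported S x).2
      ((hJ x (Finset.mem_union_right _ hx)).trans Set.subset_union_left), ?_⟩
    have h1 := LinearMap.congr_fun hρinc (res x)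
    rw [LinearMap.comp_apply, hres x (Finset.mem_union_right _ hx), LinearMap.comp_apply,
      Submodule.mkQ_apply, (Submodule.Quotient.mk_eq_zero N₀).2
        (Submodule.subset_span ⟨x, hx, rfl⟩), map_zero] at h1
    exact h1

/-- Let `C` be a class of finitely presented modules. If all maps from finitely presented modules
to `M` factor through `C`, then `M` is a direct limit of modules in `C`. -/
theorem dirLim_of_forall_factor
    (hiso : ∀ {X Y : ModuleCat.{u} S}, (X ≃ₗ[S] Y) → C X → C Y)
    (hfp : ∀ {X : ModuleCat.{u} S}, C X → Module.FinitePresentation S X)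
    (h : ∀ (X : ModuleCat.{u} S) (g : X →ₗ[S] M), Module.FinitePresentation S X →
      ∃ (Y : ModuleCat.{u} S) (a : X →ₗ[S] Y) (b : Y →ₗ[S] M), C Y ∧ b ∘ₗ a = g) :
    dirLim C (ModuleCat.of S M) := by
  refine dirLim_of_approximation (π := Finsupp.linearCombination S (Prod.fst : M × ℕ → M))
    (fun m => ⟨Finsupp.single (m, 0) 1, by simp⟩) (Approximation.exists_of_finite hiso hfp h)

end Lenzing

end DirectLimits

/-! ### Direct limits of modules of projective dimension at most one. -/

section DirectLimitsOfP1

variable {R : Type u} [Ring R]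

theorem ker_le_of_exact {S A B Y : Type*} [Ring S] [AddCommGroup A] [Module S A] [AddCommGroup B]
    [Module S B] [AddCommGroup Y] [Module S Y] {m : ℕ} {d : (Fin m → S) →ₗ[S] A} {q : A →ₗ[S] B}
    (hd : Function.Exact d q) {w : A →ₗ[S] Y} (h : ∀ l, w (d (Pi.single l 1)) = 0) :
    LinearMap.ker q ≤ LinearMap.ker w := by
  rw [hd.linearMap_ker_eq, LinearMap.range_le_ker_iff]
  apply LinearMap.pi_ext'
  intro l
  ext
  exact h l

/-- A map from a finitely presented module to a module of projective dimension at most one factors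
through a finitely presented module of projective dimension at most one. -/
theorem exists_factor_P1fp {X G : ModuleCat.{u} Rᵐᵒᵖ} (hX : Module.FinitePresentation Rᵐᵒᵖ X)
    (hG : P1 R G) (g : X →ₗ[Rᵐᵒᵖ] G) :
    ∃ (Y : ModuleCat.{u} Rᵐᵒᵖ) (a : X →ₗ[Rᵐᵒᵖ] Y) (b : Y →ₗ[Rᵐᵒᵖ] G), P1fp R Y ∧ b ∘ₗ a = g := by
  classical
  let p : (G →₀ Rᵐᵒᵖ) →ₗ[Rᵐᵒᵖ] G := Finsupp.linearCombination Rᵐᵒᵖ id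
  have hp : Function.Surjective p := Finsupp.linearCombination_id_surjective Rᵐᵒᵖ G
  let i := (LinearMap.ker p).subtype
  have hip : Function.Exact i p := LinearMap.exact_subtype_ker_map p
  have hK : Module.Projective Rᵐᵒᵖ (LinearMap.ker p) :=
    (P1_iff_projective (K := ModuleCat.of Rᵐᵒᵖ (LinearMap.ker p))
      (F := ModuleCat.of Rᵐᵒᵖ (G →₀ Rᵐᵒᵖ)) (i := i) Subtype.val_injective hip hp).1 hG
  -- The projective kernel is replaced by a free module at the cost of a free summand in the target,
  -- so that finite-rank restrictions exist.
  obtain ⟨s, r, d, -, hd, hds, hfst⟩ := exists_free_injection (K := LinearMap.ker p) i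
    Subtype.val_injective
  obtain ⟨n, m, q, z, hq, hz⟩ := Module.FinitePresentation.exists_fin' Rᵐᵒᵖ X
  obtain ⟨v, hv⟩ := Module.projective_lifting_property p (g ∘ₗ q) hp
  have hk : ∀ l : Fin m, ∃ k, i k = v (z (Pi.single l 1)) := fun l => (hip _).1 (by
    have := LinearMap.congr_fun hv (z (Pi.single l 1))
    rwa [LinearMap.comp_apply, LinearMap.comp_apply, hz.apply_apply_eq_zero, map_zero] at this)
  choose k hk using hk
  let v' := LinearMap.inl Rᵐᵒᵖ _ (LinearMap.ker p →₀ Rᵐᵒᵖ) ∘ₗ v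
  -- The finite-rank pieces contain the lifted generators of `X` and the witnesses of its relations.
  -- Hence the generators define a map from `X` to the cokernel of `d'`, which serves as `Y`.
  obtain ⟨n', m', e, r₁, e', r₂, d', hre, hre', hcomm, hs, ht⟩ :=
    exists_finite_free_restriction d (Finset.univ.image fun l => s (k l))
      (Finset.univ.image fun l => v' (Pi.single l 1))
  have hd' : Function.Injective d' := by
    have h1 : Function.Injective (d ∘ₗ e) :=
      hd.comp (Function.LeftInverse.injective (LinearMap.congr_fun hre))
    rw [← hcomm] at h1
    exact Function.Injective.of_comp h1
  have hv' : e' ∘ₗ r₂ ∘ₗ v' = v' := by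
    apply LinearMap.pi_ext'
    intro l
    ext1
    exact ht _ (Finset.mem_image_of_mem _ (Finset.mem_univ l))
  have hker : ∀ l, ((LinearMap.range d').mkQ ∘ₗ r₂ ∘ₗ v') (z (Pi.single l 1)) = 0 := by
    intro l
    refine (Submodule.Quotient.mk_eq_zero _).2 ⟨r₁ (s (k l)), ?_⟩
    have h1 : v' (z (Pi.single l 1)) = d (s (k l)) := by
      rw [← LinearMap.comp_apply d, hds]
      exact congrArg (LinearMap.inl Rᵐᵒᵖ _ _) (hk l).symm
    rw [LinearMap.comp_apply, h1, ← hs (s (k l)) (Finset.mem_image_of_mem _ (Finset.mem_univ l)),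
      ← LinearMap.comp_apply d, ← hcomm, LinearMap.comp_apply, ← LinearMap.comp_apply r₂, hre',
      LinearMap.id_apply, hs (s (k l)) (Finset.mem_image_of_mem _ (Finset.mem_univ l))]
  obtain ⟨a, ha⟩ := exists_descend hq _ (ker_le_of_exact hz hker)
  have hb : LinearMap.range d' ≤ LinearMap.ker (p ∘ₗ LinearMap.fst Rᵐᵒᵖ _ _ ∘ₗ e') := by
    rw [LinearMap.range_le_ker_iff, LinearMap.comp_assoc, LinearMap.comp_assoc, hcomm,
      ← LinearMap.comp_assoc _ d, hfst]
    exact LinearMap.ext fun y => hip.apply_apply_eq_zero (r (e y))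
  refine ⟨ModuleCat.of Rᵐᵒᵖ ((Fin m' → Rᵐᵒᵖ) ⧸ LinearMap.range d'), a,
    (LinearMap.range d').liftQ _ hb, P1fp_coker hd', ?_⟩
  rw [← LinearMap.cancel_right hq, LinearMap.comp_assoc, ha, ← LinearMap.comp_assoc,
    Submodule.liftQ_mkQ, ← hv]
  ext1 x
  have := LinearMap.congr_fun hv'
  ext
  simp only [LinearMap.comp_apply] at this ⊢
  rw [this]
  rfl

theorem dirLim_mono {S : Type u} [Ring S] {C D : ObjectProperty (ModuleCat.{u} S)}
    (h : C ≤ D) : dirLim C ≤ dirLim D := fun _ ⟨I, h1, h2, h3, G, f, h4, h5, h6⟩ =>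
  ⟨I, h1, h2, h3, G, f, h4, fun i => h _ (h5 i), h6⟩

theorem exists_factor_of_dirLim {S : Type u} [Ring S] {C : ObjectProperty (ModuleCat.{u} S)}
    {X M : ModuleCat.{u} S} (hX : Module.FinitePresentation S X) (hM : dirLim C M)
    (g : X →ₗ[S] M) :
    ∃ (Y : ModuleCat.{u} S) (a : X →ₗ[S] Y) (b : Y →ₗ[S] M), C Y ∧ b ∘ₗ a = g := by
  classical
  obtain ⟨I, _, _, _, G, f, _, hC, ⟨e⟩⟩ := hM
  obtain ⟨i, g', hg'⟩ := exists_factor_directLimit (e.toLinearMap ∘ₗ g)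
  refine ⟨G i, g', e.symm.toLinearMap ∘ₗ Module.DirectLimit.of S I (fun i => G i) f i, hC i, ?_⟩
  rw [LinearMap.comp_assoc, hg', ← LinearMap.comp_assoc, LinearEquiv.symm_comp, LinearMap.id_comp]

theorem F1_of_equiv {H H' : ModuleCat.{u} Rᵐᵒᵖ} (e : H ≃ₗ[Rᵐᵒᵖ] H') (hH : F1 R H) : F1 R H' := by
  obtain ⟨K, F, i, p, hF, hK, hi, hip, hp⟩ := hH
  exact ⟨K, F, i, e.toLinearMap ∘ₗ p, hF, hK, hi, (e.injective.comp_exact_iff_exact).2 hip,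
    e.surjective.comp hp⟩

theorem P1_of_retract {H H' : ModuleCat.{u} Rᵐᵒᵖ} {a : H →ₗ[Rᵐᵒᵖ] H'} {b : H' →ₗ[Rᵐᵒᵖ] H}
    (h : b ∘ₗ a = LinearMap.id) (hH' : P1 R H') : P1 R H := by
  have : HasProjectiveDimensionLT H' 2 := hH'
  exact Retract.hasProjectiveDimensionLT
    (⟨ModuleCat.ofHom a, ModuleCat.ofHom b, ModuleCat.hom_ext h⟩ : Retract H H') 2

theorem F1fp_of_equiv {H H' : ModuleCat.{u} Rᵐᵒᵖ} (e : H ≃ₗ[Rᵐᵒᵖ] H') (hH : F1fp R H) :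
    F1fp R H' :=
  have := hH.2
  ⟨F1_of_equiv e hH.1, Module.FinitePresentation.of_equiv e⟩

theorem P1fp_of_equiv {H H' : ModuleCat.{u} Rᵐᵒᵖ} (e : H ≃ₗ[Rᵐᵒᵖ] H') (hH : P1fp R H) :
    P1fp R H' :=
  have := hH.2
  ⟨P1_of_retract (a := e.symm.toLinearMap) (b := e.toLinearMap) (by simp) hH.1,
    Module.FinitePresentation.of_equiv e⟩

variable (R) in
/-- `lim→ 𝓟₁^fp = lim→ 𝓟₁`. -/
theorem dirLim_P1fp_eq : dirLim (P1fp R) = dirLim (P1 R) := by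
  apply le_antisymm (dirLim_mono fun _ h => h.1)
  intro M hM
  refine dirLim_of_forall_factor (C := P1fp R) (M := M) P1fp_of_equiv (fun h => h.2)
    fun X g hX => ?_
  obtain ⟨Y, a, b, hY, hab⟩ := exists_factor_of_dirLim hX hM g
  obtain ⟨Z, a', b', hZ, hab'⟩ := exists_factor_P1fp hX hY a
  exact ⟨Z, a', b ∘ₗ b', hZ, by rw [LinearMap.comp_assoc, hab', hab]⟩

theorem F1fp_le_dirLim : F1fp R ≤ dirLim (F1fp R) := fun M hM =>
  dirLim_of_forall_factor (C := F1fp R) (M := M) F1fp_of_equiv (fun h => h.2)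
    fun _ g _ => ⟨M, g, LinearMap.id, hM, rfl⟩

end DirectLimitsOfP1

/-! ### Coherence and its links with the other conditions. -/

section Coherence

variable {R : Type u} [Ring R]

/-- A finite generating set lies in a free summand of finite rank, and the projection to it is
injective on the submodule. -/
theorem isRightF1fpCoherent_of_finite_rank
    (h : ∀ (n : ℕ) (N : Submodule Rᵐᵒᵖ (Fin n → Rᵐᵒᵖ)), N.FG →
      IsFlatRight R (ModuleCat.of Rᵐᵒᵖ N) → Module.FinitePresentation Rᵐᵒᵖ N) :
    IsRightF1fpCoherent R := by
  intro L N hL hN hflat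
  obtain ⟨s, rfl⟩ := hN
  obtain ⟨n, e, r, -, hs⟩ := exists_finite_free_summand (S := Rᵐᵒᵖ) s
  have hN : Set.EqOn (e ∘ₗ r) LinearMap.id (Submodule.span Rᵐᵒᵖ (s : Set L)) :=
    LinearMap.eqOn_span' hs
  let N := Submodule.span Rᵐᵒᵖ (s : Set L)
  let f : N ≃ₗ[Rᵐᵒᵖ] N.map r := LinearEquiv.ofBijective (r.submoduleMap N)
    ⟨fun x y hxy => Subtype.ext ((hN x.2).symm.trans
      ((congrArg (fun z => e z.1) hxy).trans (hN y.2))), r.submoduleMap_surjective N⟩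
  have := h n (N.map r) ((Submodule.fg_span s.finite_toSet).map r)
    (isFlatRight_of_leftInverse (s := f.symm.toLinearMap) (r := f.toLinearMap) (by simp) hflat)
  exact Module.FinitePresentation.of_equiv f.symm

theorem isRightF1fpCoherent_of_pi (h : ∀ I : Type u, F1fpFlat R (ModuleCat.of R (I → R))) :
    IsRightF1fpCoherent R :=
  isRightF1fpCoherent_of_finite_rank fun n N hN hflat =>
    finitePresentation_of_injective_tensorMap_pi hN fun I => F1fpFlat_iff.1 (h I) n N hN hflat

/-- Coherence makes the finitely generated flat kernel finitely presented, hence projective. -/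
theorem F1fp_eq_P1fp_of_coherent (h : IsRightF1fpCoherent R) : F1fp R = P1fp R := by
  apply le_antisymm _ P1fp_le_F1fp
  intro H hH
  obtain ⟨n, p, hp, hfg, hflat⟩ := hH.exists_presentation
  have := h (ModuleCat.of Rᵐᵒᵖ (Fin n → Rᵐᵒᵖ)) (LinearMap.ker p)
    (inferInstanceAs (Module.Free Rᵐᵒᵖ (Fin n → Rᵐᵒᵖ))) hfg hflat
  refine ⟨?_, hH.2⟩
  exact (P1_iff_projective (K := ModuleCat.of Rᵐᵒᵖ (LinearMap.ker p))
    (F := ModuleCat.of Rᵐᵒᵖ (Fin n → Rᵐᵒᵖ)) (i := (LinearMap.ker p).subtype)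
    Subtype.val_injective (LinearMap.exact_subtype_ker_map p) hp).2
    (projective_of_flat_of_finitePresentation hflat)

theorem isTwoPresented_of_P1fp {H : ModuleCat.{u} Rᵐᵒᵖ} (hH : P1fp R H) :
    IsTwoPresented Rᵐᵒᵖ H := by
  have := hH.2
  obtain ⟨n, p, hp⟩ := Module.Finite.exists_fin' Rᵐᵒᵖ H
  have hK : Module.Projective Rᵐᵒᵖ (LinearMap.ker p) :=
    (P1_iff_projective (K := ModuleCat.of Rᵐᵒᵖ (LinearMap.ker p))
      (F := ModuleCat.of Rᵐᵒᵖ (Fin n → Rᵐᵒᵖ)) (i := (LinearMap.ker p).subtype)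
      Subtype.val_injective (LinearMap.exact_subtype_ker_map p) hp).1 hH.1
  have : Module.Finite Rᵐᵒᵖ (LinearMap.ker p) :=
    Module.Finite.iff_fg.2 (Module.FinitePresentation.fg_ker p hp)
  have := Module.finitePresentation_of_projective Rᵐᵒᵖ (LinearMap.ker p)
  obtain ⟨n₁, n₂, q, d, hq, hd⟩ := Module.FinitePresentation.exists_fin' Rᵐᵒᵖ (LinearMap.ker p)
  refine ⟨n, n₁, n₂, d, (LinearMap.ker p).subtype ∘ₗ q, p, fun x => ?_, fun x => ?_, hp⟩
  · rw [← hd x]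
    exact map_eq_zero_iff (LinearMap.ker p).subtype Subtype.val_injective
  · constructor
    · intro hx
      obtain ⟨y, hy⟩ := hq ⟨x, hx⟩
      exact ⟨y, congrArg Subtype.val hy⟩
    · rintro ⟨y, rfl⟩
      exact (q y).2

/-- In a 2-presented module, the kernel of every epimorphism from a finitely generated projective
module is finitely presented. -/
theorem IsTwoPresented.finitePresentation_ker {S H F : Type u} [Ring S] [AddCommGroup H]
    [Module S H] [AddCommGroup F] [Module S F] [Module.Finite S F] [Module.Projective S F]
    (hH : IsTwoPresented S H) {p : F →ₗ[S] H} (hp : Function.Surjective p) :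
    Module.FinitePresentation S (LinearMap.ker p) := by
  obtain ⟨n₀, n₁, n₂, d₂, d₁, q, h₂, h₁, hq⟩ := hH
  have hF₁ := Module.finitePresentation_of_projective S (Fin n₁ → S)
  have hF := Module.finitePresentation_of_projective S F
  have hK : Module.FinitePresentation S (LinearMap.ker q) := by
    rw [h₁.linearMap_ker_eq]
    refine Module.finitePresentation_of_surjective d₁.rangeRestrict d₁.surjective_rangeRestrict ?_
    rw [LinearMap.ker_rangeRestrict, h₂.linearMap_ker_eq, LinearMap.range_eq_map]
    exact Module.Finite.fg_top.map d₂
  -- Schanuel's argument: `E` is an extension of `F` by `ker q`, hence finitely presented, and `ker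
  -- p` splits off `E` because the other quotient is free.
  obtain ⟨E, a, b, a', b', ha, hab, hb, ha', hab', hb', -, -⟩ := exists_pullback
    (K := LinearMap.ker p) (i := (LinearMap.ker p).subtype) Subtype.val_injective
    (LinearMap.exact_subtype_ker_map p) hp (K' := LinearMap.ker q) (i' := (LinearMap.ker q).subtype)
    Subtype.val_injective (LinearMap.exact_subtype_ker_map q) hq
  have hker : Module.FinitePresentation S (LinearMap.ker b') :=
    Module.FinitePresentation.of_equiv ((LinearEquiv.ofInjective a' ha').trans
      (LinearEquiv.ofEq _ _ hab'.linearMap_ker_eq.symm))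
  have hE : Module.FinitePresentation S E := Module.finitePresentation_of_ker b' hb'
  exact Module.finitePresentation_of_projective_of_exact a b ha hb hab

theorem isRightF1fpCoherent_of_isTwoPresented
    (h : ∀ M : ModuleCat.{u} Rᵐᵒᵖ, F1fp R M → IsTwoPresented Rᵐᵒᵖ M) : IsRightF1fpCoherent R := by
  refine isRightF1fpCoherent_of_finite_rank fun n N hN hflat => ?_
  have := (h _ (F1fp_quotient hN hflat)).finitePresentation_ker N.mkQ_surjective
  rwa [N.ker_mkQ] at this

theorem F1fpFlat_eq_P1Flat_of_eq (h : F1fp R = P1fp R) : F1fpFlat R = P1Flat R := by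
  apply le_antisymm
  · intro M hM
    apply P1Flat_of_P1fpFlat
    rwa [← h]
  · intro M hM H hH
    rw [h] at hH
    exact hM H hH.1

/-- The usual triple identity of a Galois connection. -/
theorem rightTorOrth_hat (C : ObjectProperty (ModuleCat.{u} Rᵐᵒᵖ)) :
    rightTorOrth (hat C) = rightTorOrth C :=
  le_antisymm (fun _ hM H hH => hM H fun _ hN => hN H hH) fun M hM _ hH => hH M hM

/-- The identity of a finitely presented direct limit factors through a stage, so the module is a
retract of a member of `P1`. -/
theorem F1fp_eq_P1fp_of_dirLim_eq (h : dirLim (F1fp R) = dirLim (P1 R)) : F1fp R = P1fp R := by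
  apply le_antisymm _ P1fp_le_F1fp
  intro H hH
  have hlim : dirLim (P1 R) H := h ▸ F1fp_le_dirLim H hH
  obtain ⟨Y, a, b, hY, hab⟩ := exists_factor_of_dirLim hH.2 hlim LinearMap.id
  exact ⟨P1_of_retract hab hY, hH.2⟩

theorem F1fpFlat_of_isTorsionless (h : ∀ I : Type u, F1fpFlat R (ModuleCat.of R (I → R)))
    {M : ModuleCat.{u} R} (hM : IsTorsionless R M) : F1fpFlat R M := by
  refine F1fpFlat_of_injective (M' := ModuleCat.of R ((M →ₗ[R] R) → R))
    (LinearMap.pi fun φ => φ) ?_ (h _)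
  rw [injective_iff_map_eq_zero]
  exact fun m hm => hM m fun φ => congrFun hm φ

end Coherence

end FOneCoherence

open FOneCoherence

/-! ### The equivalences. -/

theorem theorem3p2 (R : Type u) [Ring R] :
    List.TFAE [
      -- (1)
      IsRightF1fpCoherent R,
      -- (2)
      ∀ (I : Type u) (M : I → ModuleCat.{u} R), (∀ i, F1fpFlat R (M i)) →
        F1fpFlat R (ModuleCat.of R (∀ i, M i)),
      -- (3)
      ∀ (I : Type u) (M : I → ModuleCat.{u} R), (∀ i, IsFlatLeft R (M i)) →
        F1fpFlat R (ModuleCat.of R (∀ i, M i)),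
      -- (4)
      ∀ I : Type u, F1fpFlat R (ModuleCat.of R (I → R)),
      -- (5)
      ∀ (I : Type u) [Preorder I] (M : I → ModuleCat.{u} R)
        (f : ∀ ⦃i j : I⦄, i ≤ j → M j →ₗ[R] M i),
        InverseSystem (F := fun i => M i) (fun _ _ h => f h) → (∀ i, F1fpFlat R (M i)) →
          F1fpFlat R (ModuleCat.of R (inverseLimit M f)),
      -- (6)
      ∀ M : ModuleCat.{u} Rᵐᵒᵖ, F1fp R M → IsTwoPresented Rᵐᵒᵖ M,
      -- (7)
      F1fp R = P1fp R,
      -- (8)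
      ∀ M : ModuleCat.{u} R, F1fpFlat R M ↔ F1fpFlat R (doubleChar M),
      -- (9)
      ∀ M : ModuleCat.{u} R, IsTorsionless R M → F1fpFlat R M,
      -- (10)
      F1fpFlat R = P1Flat R,
      -- (11)
      dirLim (F1fp R) = dirLim (P1 R),
      -- (12)
      hat (P1 R) = hat (F1fp R)] := by
  tfae_have 1 → 7 := F1fp_eq_P1fp_of_coherent
  tfae_have 7 → 10 := F1fpFlat_eq_P1Flat_of_eq
  tfae_have 10 → 2 := by
    intro h I M hM
    rw [h] at hM ⊢
    exact P1Flat_pi hM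
  tfae_have 2 → 3 := fun h I M hM => h I M fun i => F1fpFlat_of_isFlatLeft (hM i)
  tfae_have 3 → 4 := fun h I => h I (fun _ => ModuleCat.of R R) fun _ => isFlatLeft_self R
  tfae_have 4 → 1 := isRightF1fpCoherent_of_pi
  tfae_have 2 → 5 := fun h I _ M f _ hM =>
    F1fpFlat_of_injective (inverseLimit M f).subtype Subtype.val_injective (h I M hM)
  tfae_have 5 → 4 := by
    intro h I
    -- Under the equality preorder compatibility is vacuous, so the inverse limit is the whole
    -- power.
    let _ : Preorder I :=
      { le := Eq
        le_refl := Eq.refl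
        le_trans := fun _ _ _ => Eq.trans }
    have h5 := h I (fun _ => ModuleCat.of R R) (fun _ _ _ => LinearMap.id)
      ⟨fun _ _ => rfl, fun _ _ _ _ _ _ => rfl⟩
      fun _ => F1fpFlat_of_isFlatLeft (isFlatLeft_self R)
    refine F1fpFlat_of_injective (LinearMap.codRestrict _ LinearMap.id ?_) ?_ h5
    · rintro x i j (rfl : i = j)
      rfl
    · exact fun x y hxy => congrArg Subtype.val hxy
  tfae_have 4 → 9 := fun h M hM => F1fpFlat_of_isTorsionless h hM
  tfae_have 9 → 4 := fun h I => h _ fun m hm => funext fun i => hm (LinearMap.proj i)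
  tfae_have 7 → 6 := fun h M hM => isTwoPresented_of_P1fp (h ▸ hM)
  tfae_have 6 → 1 := isRightF1fpCoherent_of_isTwoPresented
  tfae_have 10 → 8 := by
    intro h M
    refine ⟨fun hM => ?_, F1fpFlat_of_injective _ (evalDoubleChar_injective M)⟩
    rw [h] at hM ⊢
    exact P1Flat_doubleChar hM
  tfae_have 8 → 4 := by
    intro h I
    obtain ⟨f, hf⟩ := exists_injective_pi_doubleChar (R := R) I
    exact F1fpFlat_of_injective (M := ModuleCat.of R (I → R)) f hf
      ((h _).1 (F1fpFlat_of_isFlatLeft (isFlatLeft_finsupp I)))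
  tfae_have 10 → 12 := fun h => (congrArg leftTorOrth h).symm
  tfae_have 12 → 10 := by
    intro h
    -- Taking orthogonals again recovers the flatness classes from their closures.
    have := congrArg rightTorOrth h
    rw [rightTorOrth_hat, rightTorOrth_hat] at this
    exact this.symm
  tfae_have 7 → 11 := by
    intro h
    rw [h, dirLim_P1fp_eq]
  tfae_have 11 → 7 := F1fp_eq_P1fp_of_dirLim_eq
  tfae_finish
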